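/- Let $G$ be a finite simple graph with vertices $v_1,\dots,v_n$ and $m$ edges, let $D(G)$ and $A(G)$ be its degree matrix and adjacency matrix, let $\beta,\gamma\in\mathbb{R}$ and let $1\le k\le n$. For a partition $\lambda$ of $n$ let $\chi_\lambda$ be the irreducible character of the symmetric group $\mathcal{S}_n$ indexed by $\lambda$, and for an $n\times n$ matrix $M=[m_{ij}]$ let $\operatorname{Imm}_\lambda(M)=\sum_{\sigma\in\mathcal{S}_n}\chi_\lambda(\sigma)\prod_{i=1}^n m_{i\sigma(i)}$. Write $$\operatorname{Imm}_{(k,1^{n-k})}\big(xI-\beta D(G)-\gamma A(G)\big)=\sum_{r=0}^{n}(-1)^r c_r\,x^{n-r}.$$ Notation: $\mathscr{C}_l$ is the set of cycles of length $l$ of $G$ (as subgraphs) and $\mathscr{M}_l$ the set of its $l$-matchings (sets of $l$ pairwise disjoint edges); $d(v)$ is the degree of $v$ in $G$. For a set $S$ of vertices, $F_r(S)$ is the $r$th elementary symmetric function of the numbers $d(v)$, $v\in S$, and $F_r=F_r(V(G))$. Further, $\mathcal{C}_r^{l}=\sum_{C\in\mathscr{C}_l}F_{r-l}(V(G)\setminus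 V(C))$ for $r\ge l$ and $\mathcal{M}_r^{l}=\sum_{\mathfrak{M}\in\mathscr{M}_l}F_{r-2l}(V(G)\setminus V(\mathfrak{M}))$ for $r\ge 2l$, where $V(\mathfrak{M})$ is the set of vertices covered by $\mathfrak{M}$; and $\mathscr{T}(C)=\sum_{v\in V(C)}d(v)$ for a triangle $C$. Binomial coefficients $\binom{a}{b}$ with $b<0$ or $b>a\geq 0$ are $0$. Put $$s=\frac{2k-n-1}{k-1}\binom{n-2}{k-2}\quad\text{if } k\ge 2,\qquad s=-1\quad\text{if } k=1.$$ Then \begin{align*} c_0&=\binom{n-1}{k-1},\\ c_1&=\beta F_1\binom{n-1}{k-1}=2m\beta\binom{n-1}{k-1},\\ c_2&=\beta^2F_2\binom{n-1}{k-1}+m\gamma^2 s\qquad(n\ge 3),\\ c_3&=\beta^3F_3\binom{n-1}{k-1}+\beta\gamma^2\mathcal{M}_3^{1}s+2|\mathscr{C}_3|\gamma^3\Big[\binom{n-4}{k-4}+\binom{n-4}{k-1}\Big]\qquad(n\ge 4),\\ c_4&=\beta^4F_4\binom{n-1}{k-1}+\beta^2\gamma^2\mathcal{M}_4^{1}s+2\beta\gamma^3\mathcal{C}_4^{3}\Big[\binom{n-4}{k-4}+\binom{n-4}{k-1}\Big]+2|\mathscr{C}_4|\gamma^4\Big[\binom{n-5}{k-5}-\binom{n-5}{k-1}\Big]\\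 &\quad+\Big[\binom m2-\sum_{i=1}^n\binom{d(v_i)}2\Big]\gamma^4\Big[\binom{n-5}{k-5}-2\binom{n-5}{k-3}+\binom{n-5}{k-1}\Big]\qquad(n\ge 5),\\ c_5&=\beta^5F_5\binom{n-1}{k-1}+\beta^3\gamma^2\mathcal{M}_5^{1}s+2\beta^2\gamma^3\mathcal{C}_5^{3}\Big[\binom{n-4}{k-4}+\binom{n-4}{k-1}\Big]+2\beta\gamma^4\mathcal{C}_5^{4}\Big[\binom{n-5}{k-5}-\binom{n-5}{k-1}\Big]\\ &\quad+\beta\gamma^4\mathcal{M}_5^{2}\Big[\binom{n-5}{k-5}-2\binom{n-5}{k-3}+\binom{n-5}{k-1}\Big]+2|\mathscr{C}_5|\gamma^5\Big[\binom{n-6}{k-6}+\binom{n-6}{k-1}\Big]\\ &\quad+\sum_{C\in\mathscr{C}_3}2\big(m+3-\mathscr{T}(C)\big)\gamma^5\Big[\binom{n-6}{k-6}+\binom{n-6}{k-3}-\binom{n-6}{k-4}-\binom{n-6}{k-1}\Big]\qquad(n\ge 6). \end{align*} -/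

import Mathlib

noncomputable section

open Polynomial

namespace HookImmanant

/-! ### Irreducible characters of the symmetric group -/

/-- The Young diagram of a partition `lam` of `n`: its row lengths are the parts of `lam`, in
weakly decreasing order. -/
def diagram {n : ℕ} (lam : n.Partition) : YoungDiagram :=
  YoungDiagram.ofRowLens (lam.parts.sort (· ≥ ·)) (Multiset.pairwise_sort _ _).sortedGE

/-- A Young tableau of shape `lam`: a bijective filling of the cells of the diagram with the
elements of `Fin n`. -/
abbrev Tableau {n : ℕ} (lam : n.Partition) : Type := ↥(diagram lam).cells ≃ Fin n

/-- The row of the tableau `t` that contains the entry `i`. The tabloid `{t}` (the class of `t` up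
to permutations of the entries within each row) is represented by this function `Fin n → ℕ`. -/
def rowOf {n : ℕ} {lam : n.Partition} (t : Tableau lam) (i : Fin n) : ℕ := (t.symm i).1.1

/-- The column of the tableau `t` that contains the entry `i`. -/
def colOf {n : ℕ} {lam : n.Partition} (t : Tableau lam) (i : Fin n) : ℕ := (t.symm i).1.2

/-- The polytabloid `e_t = ∑ sgn(π) {π t}`, where `π` runs over the column stabilizer of `t`. -/
def polytabloid {n : ℕ} {lam : n.Partition} (t : Tableau lam) : (Fin n → ℕ) →₀ ℂ :=
  ∑ π : Equiv.Perm (Fin n) with ∀ i, colOf t (π i) = colOf t i,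
    ((Equiv.Perm.sign π : ℤ) : ℂ) • Finsupp.single (rowOf (t.trans π)) (1 : ℂ)

/-- The action of the symmetric group on row functions: as `rowOf (σ t) i = rowOf t (σ⁻¹ i)`, it
sends the tabloid `{t}` to `{σ t}`. -/
def rowRep (n : ℕ) : Representation ℂ (Equiv.Perm (Fin n)) ((Fin n → ℕ) →₀ ℂ) where
  toFun σ := Finsupp.lmapDomain ℂ ℂ (fun f i => f (σ⁻¹ i))
  map_one' := by ext; simp
  map_mul' σ τ := by ext; simp

theorem rowRep_single {n : ℕ} (σ : Equiv.Perm (Fin n)) (f : Fin n → ℕ) (a : ℂ) :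
    rowRep n σ (Finsupp.single f a) = Finsupp.single (fun i => f (σ⁻¹ i)) a := by
  simp [rowRep]

theorem rowRep_polytabloid {n : ℕ} {lam : n.Partition} (σ : Equiv.Perm (Fin n))
    (t : Tableau lam) : rowRep n σ (polytabloid t) = polytabloid (t.trans σ) := by
  unfold polytabloid
  rw [map_sum]
  refine Finset.sum_bij' (fun π _ => σ * π * σ⁻¹) (fun π _ => σ⁻¹ * π * σ) ?_ ?_ ?_ ?_ ?_
  · intro π hπ
    simp only [Finset.mem_filter, Finset.mem_univ, true_and] at hπ ⊢
    intro i
    have := hπ (σ⁻¹ i)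
    simpa [colOf] using this
  · intro π hπ
    simp only [Finset.mem_filter, Finset.mem_univ, true_and] at hπ ⊢
    intro i
    have := hπ (σ i)
    simpa [colOf] using this
  · intro π _
    group
  · intro π _
    group
  · intro π _
    rw [map_smul, rowRep_single]
    congr 1
    · rw [Equiv.Perm.sign_mul, Equiv.Perm.sign_mul, Equiv.Perm.sign_inv, mul_right_comm,
        Int.units_mul_self, one_mul]
    · congr 1
      funext i
      have h : (σ * π * σ⁻¹)⁻¹ = σ * π⁻¹ * σ⁻¹ := by group
      have h' : σ.symm (((σ * π * σ⁻¹)⁻¹ : Equiv.Perm (Fin n)) i) = π⁻¹ (σ⁻¹ i) := by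
        rw [h]; simp
      exact congrArg (fun x => (t.symm x).1.1) h'.symm

/-- The Specht module `S^lam` over the complex numbers: the span of all polytabloids of shape
`lam`, with the permutation action of the symmetric group. -/
def specht {n : ℕ} (lam : n.Partition) : Subrepresentation (rowRep n) where
  toSubmodule := Submodule.span ℂ (Set.range (polytabloid (lam := lam)))
  apply_mem_toSubmodule σ v hv := by
    refine Submodule.span_induction ?_ ?_ ?_ ?_ hv
    · rintro _ ⟨t, rfl⟩
      rw [rowRep_polytabloid]
      exact Submodule.subset_span ⟨_, rfl⟩
    · simp
    · intro x y _ _ hx hy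
      rw [map_add]
      exact Submodule.add_mem _ hx hy
    · intro a x _ hx
      rw [map_smul]
      exact Submodule.smul_mem _ _ hx

/-- The irreducible character `χ_lam` of the symmetric group on `n` letters: the character of the
Specht module `S^lam`. -/
def irrChar {n : ℕ} (lam : n.Partition) (σ : Equiv.Perm (Fin n)) : ℂ :=
  LinearMap.trace ℂ (specht lam).toSubmodule ((specht lam).toRepresentation σ)

/-- The hook partition `(k, 1^(n-k))` of `n`, for `1 ≤ k ≤ n`. -/
def hookPartition (n k : ℕ) (hk : 1 ≤ k) (hkn : k ≤ n) : n.Partition where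
  parts := k ::ₘ Multiset.replicate (n - k) 1
  parts_pos := by
    intro i hi
    rcases Multiset.mem_cons.1 hi with rfl | hi
    · omega
    · rw [Multiset.eq_of_mem_replicate hi]; exact one_pos
  parts_sum := by simp; omega

/-! ### Immanants and immanantal polynomials -/

/-- The immanant of a square matrix associated with `χ_lam`. -/
def immanant {n : ℕ} {R : Type*} [CommRing R] [Algebra ℂ R] (lam : n.Partition)
    (M : Matrix (Fin n) (Fin n) R) : R :=
  ∑ σ : Equiv.Perm (Fin n), irrChar lam σ • ∏ i, M i (σ i)

/-- The immanantal polynomial `Imm_lam (x I - M)`. -/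
def immPoly {n : ℕ} (lam : n.Partition) (M : Matrix (Fin n) (Fin n) ℂ) : ℂ[X] :=
  immanant lam ((X : ℂ[X]) • (1 : Matrix (Fin n) (Fin n) ℂ[X]) - M.map C)

/-- The coefficient `c_{lam,r}(M)`, i.e. `(-1)^r` times the coefficient of `x^(n-r)` in the
immanantal polynomial (`r ≤ n`). -/
def immCoeff {n : ℕ} (lam : n.Partition) (r : ℕ) (M : Matrix (Fin n) (Fin n) ℂ) : ℂ :=
  (-1) ^ r * (immPoly lam M).coeff (n - r)

/-! ### Graph parameters -/

section Graph

variable {n : ℕ} (G : SimpleGraph (Fin n)) [DecidableRel G.Adj]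

/-- The matrix `β D(G) + γ A(G)`. -/
def linComb (β γ : ℝ) : Matrix (Fin n) (Fin n) ℂ :=
  (β : ℂ) • G.degMatrix ℂ + (γ : ℂ) • G.adjMatrix ℂ

/-- The `r`-th elementary symmetric function of the degrees (in `G`) of the vertices in `S`. -/
def degEsymm (S : Finset (Fin n)) (r : ℕ) : ℕ :=
  (S.val.map fun v => G.degree v).esymm r

/-- `F_r(G)`: the `r`-th elementary symmetric function of the degree sequence. -/
def F (r : ℕ) : ℕ := degEsymm G Finset.univ r

open Classical in
/-- The cycles of length `l` in `G` (`l ≥ 3`): the subgraphs isomorphic to the cycle `C_l`. -/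
def cycles (l : ℕ) : Finset G.Subgraph :=
  {H | Nonempty (SimpleGraph.cycleGraph l ≃g H.coe)}

open Classical in
/-- The vertex set of a subgraph, as a finset. -/
def vertsOf (H : G.Subgraph) : Finset (Fin n) := {v | v ∈ H.verts}

open Classical in
/-- The `l`-matchings of `G`: the sets of `l` edges, no two of which share a vertex. -/
def matchings (l : ℕ) : Finset (Finset (Sym2 (Fin n))) :=
  {E ∈ G.edgeFinset.powersetCard l |
    ∀ e ∈ E, ∀ f ∈ E, e ≠ f → ∀ v, ¬ (v ∈ e ∧ v ∈ f)}

/-- The vertices covered by a set of edges. -/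
def covered (E : Finset (Sym2 (Fin n))) : Finset (Fin n) := {v | ∃ e ∈ E, v ∈ e}

/-- `𝒞_r^l(G)`: the sum, over the `l`-cycles `C` of `G`, of the `(r-l)`-th elementary symmetric
function of the degrees of the vertices outside `C` (`r ≥ l`). -/
def cycleSum (r l : ℕ) : ℕ :=
  ∑ H ∈ cycles G l, degEsymm G (vertsOf G H)ᶜ (r - l)

/-- `ℳ_r^l(G)`: the sum, over the `l`-matchings of `G`, of the `(r-2l)`-th elementary
symmetric function of the degrees of the vertices that are not covered (`r ≥ 2l`). -/
def matchingSum (r l : ℕ) : ℕ :=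
  ∑ E ∈ matchings G l, degEsymm G (covered E)ᶜ (r - 2 * l)

end Graph

/-! ### Binomial coefficients -/

/-- The binomial coefficient `a` over `b` with an integer lower index, as a complex number; it is
`0` for `b < 0` and for `b > a`. -/
def binom (a : ℕ) (b : ℤ) : ℂ := if 0 ≤ b then (a.choose b.toNat : ℂ) else 0

/-- The number `(2k-n-1)/(k-1) * binom (n-2) (k-2)` for `k ≥ 2`, extended to `k = 1` by `-1`. -/
def swapValue (n k : ℕ) : ℂ :=
  if k = 1 then -1 else (2 * (k : ℂ) - n - 1) / ((k : ℂ) - 1) * binom (n - 2) ((k : ℤ) - 2)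

end HookImmanant

end

open HookImmanant

noncomputable section

open Polynomial

namespace HookImmanant

/-! ### Tableaux of hook shape -/

/-! Expanding the product in the immanant shows that c_r is the sum over σ of χ(σ) times the sum,
over the r-sets S containing the support of σ, of ∏_{i∈S} m_{iσ(i)}. For M = βD + γA this inner sum
vanishes unless σ moves each non-fixed vertex to a neighbor; if it moves s of them, the sum is γ^s
β^{r-s} F_{r-s} of the complement of the support (`sum_prod_linComb`, `immCoeff_linComb`). For r ≤ 5
these σ are the identity, transpositions along edges, cycles of length 3, 4 or 5, products of two
disjoint transpositions, and products of a 3-cycle with a disjoint transposition. Involutions with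
2l moved points correspond to l-matchings, and cyclic permutations of length l ≥ 3 correspond
two-to-one to cycles of G, so the sums over σ become the stated graph parameters.

The other ingredient is the value of the hook character at a permutation σ with a fixed point p; the
bounds on n guarantee such a point. Conceptually, the Specht module of (k,1^{n-k}) is the (n-k)-th
exterior power of the standard representation, which restricts to the stabilizer of p as the
permutation representation on the other n-1 points. Hence χ(σ) is the sum, over the σ-stable
(n-k)-sets I avoiding p, of the sign of σ on I (`irrChar_hookPartition`). The proof works directly
with polytabloids: those with p in the corner and I below it form a basis dual to evaluation at
their own tabloids. That these evaluations separate the Specht module follows from the antisymmetry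
in the entries below the first row and from the vanishing after a row is merged with the first
(`specht_eq_zero`). A stable set contains or misses each cycle of σ, so counting stable sets
according to the cycles they contain gives the binomial coefficients. -/

theorem mem_diagram_hookPartition {n k : ℕ} (hk : 1 ≤ k) (hkn : k ≤ n) (c : ℕ × ℕ) :
    c ∈ diagram (hookPartition n k hk hkn) ↔
      (c.1 = 0 ∧ c.2 < k) ∨ (1 ≤ c.1 ∧ c.1 ≤ n - k ∧ c.2 = 0) := by
  have hs : (hookPartition n k hk hkn).parts.sort (· ≥ ·) = k :: List.replicate (n - k) 1 := by
    change (k ::ₘ Multiset.replicate (n - k) 1).sort (· ≥ ·) = _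
    rw [Multiset.sort_cons]
    · congr 1
      rw [List.eq_replicate_iff]
      refine ⟨by simp, fun b hb => ?_⟩
      rw [Multiset.mem_sort] at hb
      exact Multiset.eq_of_mem_replicate hb
    · intro b hb
      rw [Multiset.eq_of_mem_replicate hb]
      exact hk
  unfold diagram
  rw [YoungDiagram.mem_ofRowLens]
  obtain ⟨r, c⟩ := c
  simp only [hs]
  cases r with
  | zero => simp
  | succ r => simp

theorem card_diagram_hookPartition {n k : ℕ} (hk : 1 ≤ k) (hkn : k ≤ n) :
    (diagram (hookPartition n k hk hkn)).cells.card = n := by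
  have h : (diagram (hookPartition n k hk hkn)).cells =
      ({0} ×ˢ Finset.range k) ∪ (Finset.Icc 1 (n - k) ×ˢ {0}) := by
    ext ⟨r, c⟩
    rw [YoungDiagram.mem_cells, mem_diagram_hookPartition, Finset.mem_union, Finset.mem_product,
      Finset.mem_product, Finset.mem_singleton, Finset.mem_singleton, Finset.mem_range,
      Finset.mem_Icc, and_assoc]
  rw [h, Finset.card_union_of_disjoint]
  · simp; omega
  · rw [Finset.disjoint_left]
    intro c hc hc'
    have h1 := Finset.mem_singleton.1 (Finset.mem_product.1 hc).1
    have h2 := (Finset.mem_Icc.1 (Finset.mem_product.1 hc').1).1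
    omega

section Tableau

variable {n k : ℕ} {hk : 1 ≤ k} {hkn : k ≤ n} (t : Tableau (hookPartition n k hk hkn))

theorem rowOf_colOf_mem (i : Fin n) :
    (rowOf t i = 0 ∧ colOf t i < k) ∨ (1 ≤ rowOf t i ∧ rowOf t i ≤ n - k ∧ colOf t i = 0) :=
  (mem_diagram_hookPartition hk hkn _).1 ((YoungDiagram.mem_cells _).1 (t.symm i).2)

theorem eq_of_rowOf_eq_of_colOf_eq {i j : Fin n} (hr : rowOf t i = rowOf t j)
    (hc : colOf t i = colOf t j) : i = j :=
  t.symm.injective (Subtype.ext (Prod.ext hr hc))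

theorem rowOf_le (i : Fin n) : rowOf t i ≤ n - k := by
  have := rowOf_colOf_mem t i
  omega

theorem colOf_eq_zero {i : Fin n} (h : rowOf t i ≠ 0) : colOf t i = 0 := by
  have := rowOf_colOf_mem t i
  omega

theorem rowOf_eq_zero {i : Fin n} (h : colOf t i ≠ 0) : rowOf t i = 0 := by
  by_contra h'
  exact h (colOf_eq_zero t h')

theorem exists_rowOf_eq {r : ℕ} (hr : r ≤ n - k) : ∃ i, rowOf t i = r ∧ colOf t i = 0 := by
  have h : (r, 0) ∈ (diagram (hookPartition n k hk hkn)).cells := by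
    rw [YoungDiagram.mem_cells, mem_diagram_hookPartition]
    change (r = 0 ∧ 0 < k) ∨ (1 ≤ r ∧ r ≤ n - k ∧ 0 = 0)
    omega
  exact ⟨t ⟨(r, 0), h⟩, by simp [rowOf], by simp [colOf]⟩

/-- Only the first column of a hook has more than one cell, so a column permutation can move nothing
outside it. -/
theorem forall_colOf_eq_iff (π : Equiv.Perm (Fin n)) :
    (∀ i, colOf t (π i) = colOf t i) ↔ ∀ i, colOf t i ≠ 0 → π i = i := by
  constructor
  · intro h i hi
    apply eq_of_rowOf_eq_of_colOf_eq t _ (h i)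
    rw [rowOf_eq_zero t hi, rowOf_eq_zero t (by rwa [h i])]
  · intro h i
    by_cases hi : colOf t i = 0
    · rw [hi]
      by_contra h'
      have := π.injective (h _ h')
      rw [this] at h'
      exact h' hi
    · rw [h i hi]

theorem polytabloid_apply (g : Fin n → ℕ) :
    polytabloid t g = ∑ π : Equiv.Perm (Fin n) with
      (∀ i, colOf t i ≠ 0 → π i = i) ∧ ∀ i, g (π i) = rowOf t i,
        ((Equiv.Perm.sign π : ℤ) : ℂ) := by
  unfold polytabloid
  rw [Finsupp.finsetSum_apply, Finset.sum_filter, Finset.sum_filter]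
  refine Finset.sum_congr rfl fun π _ => ?_
  by_cases h1 : ∀ i, colOf t i ≠ 0 → π i = i
  · rw [if_pos ((forall_colOf_eq_iff t π).2 h1)]
    have h2 : rowOf (t.trans π) = g ↔ ∀ i, g (π i) = rowOf t i := by
      constructor
      · rintro rfl i
        simp [rowOf]
      · intro h
        funext i
        have := h (π.symm i)
        simp only [Equiv.apply_symm_apply] at this
        rw [this]
        rfl
    simp only [Finsupp.smul_apply, Finsupp.single_apply, h2, smul_eq_mul, mul_ite, mul_one,
      mul_zero]
    exact if_congr (and_iff_right h1).symm rfl rfl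
  · rw [if_neg (fun h => h1 ((forall_colOf_eq_iff t π).1 h))]
    simp [h1]

end Tableau

/-- For each vertex `p` and each set `I` of `n - k` elements avoiding `p`, there is a tableau of
hook shape with `p` in the corner and `I` below it. -/
theorem exists_tableau {n k : ℕ} (hk : 1 ≤ k) (hkn : k ≤ n) (p : Fin n) (I : Finset (Fin n))
    (hp : p ∉ I) (hI : I.card = n - k) :
    ∃ t : Tableau (hookPartition n k hk hkn), rowOf t p = 0 ∧ colOf t p = 0 ∧
      ∀ i, i ∈ I ↔ rowOf t i ≠ 0 := by
  have hcard : Fintype.card ↥(diagram (hookPartition n k hk hkn)).cells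
      = Fintype.card (Fin n) := by
    rw [Fintype.card_coe, card_diagram_hookPartition, Fintype.card_fin]
  let t : Tableau (hookPartition n k hk hkn) := Fintype.equivOfCardEq hcard
  obtain ⟨a, ha, ha'⟩ := exists_rowOf_eq t (Nat.zero_le (n - k))
  have hA : (Finset.univ.filter fun i => rowOf t i ≠ 0).card = n - k := by
    rw [show n - k = (Finset.Icc 1 (n - k)).card by simp]
    refine Finset.card_bij (fun i _ => rowOf t i) ?_ ?_ ?_
    · intro i hi
      rw [Finset.mem_filter] at hi
      exact Finset.mem_Icc.2 ⟨Nat.one_le_iff_ne_zero.2 hi.2, rowOf_le t i⟩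
    · intro i hi j hj h
      rw [Finset.mem_filter] at hi hj
      exact eq_of_rowOf_eq_of_colOf_eq t h
        (by rw [colOf_eq_zero t hi.2, colOf_eq_zero t hj.2])
    · intro r hr
      obtain ⟨i, hi, -⟩ := exists_rowOf_eq t (Finset.mem_Icc.1 hr).2
      refine ⟨i, ?_, hi⟩
      rw [Finset.mem_filter]
      have := (Finset.mem_Icc.1 hr).1
      exact ⟨Finset.mem_univ _, by omega⟩
  have e : {i // rowOf t i ≠ 0} ≃ {i // i ∈ I} := by
    apply Fintype.equivOfCardEq
    rw [Fintype.card_subtype, hA, Fintype.card_coe, hI]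
  let σ := e.extendSubtype
  have hσ : ∀ i, σ i ∈ I ↔ rowOf t i ≠ 0 := fun i =>
    ⟨fun h => by
      by_contra h'
      exact e.extendSubtype_not_mem i (not_not.2 h') h, fun h => e.extendSubtype_mem i h⟩
  -- The entry `σ a` that `σ` puts in the corner lies outside `I`, and so does `p`; exchanging the
  -- two puts `p` in the corner without disturbing `I`.
  let τ := σ.trans (Equiv.swap (σ a) p)
  have haI : σ a ∉ I := fun h => (hσ a).1 h ha
  have hτp : τ a = p := by simp [τ]
  have hτ : ∀ i, τ i ∈ I ↔ σ i ∈ I := by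
    intro i
    simp only [τ, Equiv.trans_apply, Equiv.swap_apply_def]
    split_ifs with h1 h2
    · rw [h1]; simp [hp, haI]
    · rw [h2]; simp [hp, haI]
    · rfl
  refine ⟨t.trans τ, ?_, ?_, ?_⟩
  · rw [← hτp]; simpa [rowOf] using ha
  · rw [← hτp]; simpa [colOf] using ha'
  · intro i
    have := (hτ (τ.symm i)).trans (hσ (τ.symm i))
    rw [Equiv.apply_symm_apply] at this
    exact this

theorem perm_inv_apply_self {α : Type*} (π : Equiv.Perm α) (x : α) : π⁻¹ (π x) = x :=
  π.symm_apply_apply x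

theorem perm_apply_inv_self {α : Type*} (π : Equiv.Perm α) (x : α) : π (π⁻¹ x) = x :=
  π.apply_symm_apply x

/-! ### Coordinates on the Specht module of a hook -/

/-- The sign of the permutation that `σ` induces on `I`, or `0` if `I` is not stable. -/
def restrictSign {n : ℕ} (σ : Equiv.Perm (Fin n)) (I : Finset (Fin n)) : ℂ :=
  ∑ π : Equiv.Perm (Fin n) with (∀ i ∈ I, π i = σ i) ∧ ∀ i ∉ I, π i = i,
    ((Equiv.Perm.sign π : ℤ) : ℂ)

section Tableau

variable {n k : ℕ} {hk : 1 ≤ k} {hkn : k ≤ n}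

/-- This is the diagonal matrix entry of σ at e_t. After inversion of the summation index, a
contributing column permutation π satisfies `rowOf t (σ i) = rowOf t (π i)` for all i. It fixes p,
since both the row and the column of p are kept; hence it preserves I, and it agrees with σ there
because each row below the first has a single entry. -/
theorem polytabloid_apply_rowOf_perm (t : Tableau (hookPartition n k hk hkn)) {p : Fin n}
    (hp : rowOf t p = 0) (hp' : colOf t p = 0) {I : Finset (Fin n)}
    (hI : ∀ i, i ∈ I ↔ rowOf t i ≠ 0) {σ : Equiv.Perm (Fin n)} (hσ : σ p = p) :
    polytabloid t (fun i => rowOf t (σ i)) = restrictSign σ I := by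
  rw [polytabloid_apply, restrictSign, Finset.sum_filter, Finset.sum_filter,
    ← Equiv.sum_comp (Equiv.inv (Equiv.Perm (Fin n)))]
  refine Finset.sum_congr rfl fun π _ => if_congr ?_ (by simp) rfl
  simp only [Equiv.inv_apply]
  have key : ∀ i, i ∉ I → i = p ∨ colOf t i ≠ 0 := by
    intro i hi
    have h0 : rowOf t i = 0 := by
      by_contra h
      exact hi ((hI i).2 h)
    by_cases hc : colOf t i = 0
    · exact Or.inl (eq_of_rowOf_eq_of_colOf_eq t (h0.trans hp.symm) (hc.trans hp'.symm))
    · exact Or.inr hc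
  constructor
  · rintro ⟨h1, h2⟩
    have hcol := (forall_colOf_eq_iff t π⁻¹).2 h1
    have hπp : π p = p := by
      apply eq_of_rowOf_eq_of_colOf_eq t
      · rw [← h2 (π p), perm_inv_apply_self, hσ]
      · rw [← hcol (π p), perm_inv_apply_self]
    have hoff : ∀ i ∉ I, π i = i := by
      intro i hi
      rcases key i hi with rfl | hc
      · exact hπp
      · exact (Equiv.Perm.inv_eq_iff_eq.1 (h1 i hc)).symm
    refine ⟨fun i hi => ?_, hoff⟩
    have hx : π i ∈ I := by
      by_contra h
      exact h (by rwa [π.injective (hoff _ h)])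
    have h3 := h2 (π i)
    rw [perm_inv_apply_self] at h3
    have h4 := (hI _).1 hx
    exact eq_of_rowOf_eq_of_colOf_eq t h3.symm
      (by rw [colOf_eq_zero t h4, colOf_eq_zero t (h3 ▸ h4)])
  · rintro ⟨h1, h2⟩
    have hst : ∀ i ∈ I, π⁻¹ i ∈ I := by
      intro i hi
      by_contra h
      have := h2 _ h
      rw [perm_apply_inv_self] at this
      exact h (this ▸ hi)
    refine ⟨fun i hi => ?_, fun i => ?_⟩
    · have : i ∉ I := fun h => hi (colOf_eq_zero t ((hI i).1 h))
      exact Equiv.Perm.inv_eq_iff_eq.2 (h2 i this).symm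
    · by_cases hi : i ∈ I
      · rw [← h1 _ (hst i hi), perm_apply_inv_self]
      · rw [Equiv.Perm.inv_eq_iff_eq.2 (h2 i hi).symm]
        have hσi : σ i ∉ I := by
          intro h
          have h3 := hst _ h
          have h4 := h1 _ h3
          rw [perm_apply_inv_self] at h4
          exact hi (σ.injective h4 ▸ h3)
        have h5 := not_not.1 (fun h => hσi ((hI (σ i)).2 h))
        have h6 := not_not.1 (fun h => hi ((hI i).2 h))
        rw [h5, h6]

theorem polytabloid_apply_rowOf_self (t : Tableau (hookPartition n k hk hkn)) {p : Fin n}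
    (hp : rowOf t p = 0) (hp' : colOf t p = 0) {I : Finset (Fin n)}
    (hI : ∀ i, i ∈ I ↔ rowOf t i ≠ 0) : polytabloid t (rowOf t) = 1 := by
  have h := polytabloid_apply_rowOf_perm t hp hp' hI (σ := 1) rfl
  have h' : (fun i => rowOf t ((1 : Equiv.Perm (Fin n)) i)) = rowOf t := rfl
  rw [h'] at h
  rw [h, restrictSign, Finset.sum_eq_single 1]
  · simp
  · intro π hπ h1
    exfalso
    apply h1
    ext i
    rw [Finset.mem_filter] at hπ
    by_cases hi : i ∈ I
    · rw [hπ.2.1 i hi]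
    · rw [hπ.2.2 i hi]; rfl
  · intro h
    exact absurd (Finset.mem_filter.2 ⟨Finset.mem_univ _, by simp⟩) h

/-- A column permutation of t producing the tabloid of t' fixes p, which lies in the first row of
both, and hence every entry outside I. An entry of I' outside I would then be in the first row of
t', so I' ⊆ I, and equal cardinalities force I = I'. -/
theorem polytabloid_apply_rowOf_of_ne (t t' : Tableau (hookPartition n k hk hkn)) {p : Fin n}
    (hp : rowOf t p = 0) (hp' : colOf t p = 0) (hpt' : rowOf t' p = 0) {I I' : Finset (Fin n)}
    (hI : ∀ i, i ∈ I ↔ rowOf t i ≠ 0) (hI' : ∀ i, i ∈ I' ↔ rowOf t' i ≠ 0)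
    (hcard : I.card = I'.card) (hne : I ≠ I') : polytabloid t (rowOf t') = 0 := by
  rw [polytabloid_apply]
  apply Finset.sum_eq_zero
  intro π hπ
  exfalso
  obtain ⟨-, h1, h2⟩ := Finset.mem_filter.1 hπ
  have hcol := (forall_colOf_eq_iff t π).2 h1
  have hπp : π.symm p = p := by
    apply eq_of_rowOf_eq_of_colOf_eq t
    · rw [← h2, Equiv.apply_symm_apply, hp, hpt']
    · rw [← hcol, Equiv.apply_symm_apply]
  apply hne
  symm
  apply Finset.eq_of_subset_of_card_le _ hcard.le
  intro i hi
  by_contra h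
  have h0 : rowOf t i = 0 := not_not.1 fun h' => h ((hI i).2 h')
  have hfix : π i = i := by
    by_cases hc : colOf t i = 0
    · have : i = p := eq_of_rowOf_eq_of_colOf_eq t (h0.trans hp.symm) (hc.trans hp'.symm)
      rw [this]
      exact (Equiv.eq_symm_apply π).1 hπp.symm
    · exact h1 i hc
  have := h2 i
  rw [hfix, h0] at this
  exact (hI' i).1 hi this

end Tableau

/-! ### Relations satisfied by the elements of the Specht module of a hook -/

/-- Moving the entry of row `r` to the first row. -/
def mergeRow {n : ℕ} (r : ℕ) (g : Fin n → ℕ) : Fin n → ℕ := fun i => if g i = r then 0 else g i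

section Relations

variable {n k : ℕ} {hk : 1 ≤ k} {hkn : k ≤ n}

theorem polytabloid_apply_ne_zero (t : Tableau (hookPartition n k hk hkn)) {g : Fin n → ℕ}
    (h : polytabloid t g ≠ 0) : ∃ π : Equiv.Perm (Fin n), ∀ i, g (π i) = rowOf t i := by
  rw [polytabloid_apply] at h
  obtain ⟨π, hπ, -⟩ := Finset.exists_ne_zero_of_sum_ne_zero h
  exact ⟨π, (Finset.mem_filter.1 hπ).2.2⟩

/-- Left multiplication by π matches the column permutations contributing to the two coefficients.
The products still fix the entries outside the first column: those lie in the first row, which π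
leaves alone. -/
theorem polytabloid_apply_comp (t : Tableau (hookPartition n k hk hkn)) (g : Fin n → ℕ)
    (π : Equiv.Perm (Fin n)) (hπ : ∀ i, g i = 0 → π i = i) :
    polytabloid t (g ∘ π) = ((Equiv.Perm.sign π : ℤ) : ℂ) * polytabloid t g := by
  rw [polytabloid_apply, polytabloid_apply, Finset.mul_sum]
  refine Finset.sum_bij' (fun τ _ => π * τ) (fun τ _ => π⁻¹ * τ) ?_ ?_ ?_ ?_ ?_
  · intro τ hτ
    obtain ⟨-, h1, h2⟩ := Finset.mem_filter.1 hτ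
    refine Finset.mem_filter.2 ⟨Finset.mem_univ _, fun i hi => ?_, h2⟩
    have h3 := h2 i
    rw [h1 i hi, rowOf_eq_zero t hi] at h3
    rw [Equiv.Perm.mul_apply, h1 i hi]
    exact π.injective (hπ _ h3)
  · intro τ hτ
    obtain ⟨-, h1, h2⟩ := Finset.mem_filter.1 hτ
    refine Finset.mem_filter.2 ⟨Finset.mem_univ _, fun i hi => ?_, fun i => ?_⟩
    · have h3 := h2 i
      rw [h1 i hi, rowOf_eq_zero t hi] at h3
      rw [Equiv.Perm.mul_apply, h1 i hi, Equiv.Perm.inv_eq_iff_eq]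
      exact (hπ _ h3).symm
    · rw [Function.comp_apply, Equiv.Perm.mul_apply, perm_apply_inv_self, h2]
  · intro τ _
    group
  · intro τ _
    group
  · intro τ _
    rw [Equiv.Perm.sign_mul, Units.val_mul, Int.cast_mul, ← mul_assoc, ← Int.cast_mul,
      ← Units.val_mul, Int.units_mul_self, Units.val_one, Int.cast_one, one_mul]

/-- Composing a column permutation on the right with the transposition of the first-column entries
in rows 0 and r changes its sign but not the merged tabloid, so the terms cancel in pairs. -/
theorem mapDomain_mergeRow_polytabloid (t : Tableau (hookPartition n k hk hkn)) {r : ℕ}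
    (hr : 1 ≤ r) (hr' : r ≤ n - k) : (polytabloid t).mapDomain (mergeRow r) = 0 := by
  obtain ⟨a, ha, ha'⟩ := exists_rowOf_eq t (Nat.zero_le (n - k))
  obtain ⟨b, hb, hb'⟩ := exists_rowOf_eq t hr'
  have hab : a ≠ b := by
    rintro rfl
    omega
  unfold polytabloid
  rw [Finsupp.mapDomain_finsetSum]
  simp only [Finsupp.mapDomain_smul, Finsupp.mapDomain_single]
  have hcol : ∀ i, colOf t (Equiv.swap a b i) = colOf t i := by
    intro i
    rw [Equiv.swap_apply_def]
    split_ifs with h1 h2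
    · rw [h1, ha', hb']
    · rw [h2, ha', hb']
    · rfl
  have hrow : ∀ i, mergeRow r (rowOf t) (Equiv.swap a b i) = mergeRow r (rowOf t) i := by
    intro i
    rw [Equiv.swap_apply_def]
    split_ifs with h1 h2
    · simp [mergeRow, h1, ha, hb]
    · simp [mergeRow, h2, ha, hb]
    · rfl
  refine Finset.sum_involution (fun π _ => π * Equiv.swap a b) ?_ ?_ ?_ ?_
  · intro π _
    have h : mergeRow r (rowOf (t.trans (π * Equiv.swap a b)))
        = mergeRow r (rowOf (t.trans π)) := by
      funext i
      exact hrow (π.symm i)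
    rw [h, Equiv.Perm.sign_mul, Equiv.Perm.sign_swap hab]
    simp
  · intro π _ _ h
    have := Equiv.Perm.mul_apply π (Equiv.swap a b) a
    rw [h, Equiv.swap_apply_left] at this
    exact hab (π.injective this)
  · intro π hπ
    rw [Finset.mem_filter] at hπ ⊢
    exact ⟨Finset.mem_univ _, fun i => by rw [Equiv.Perm.mul_apply, hπ.2, hcol]⟩
  · intro π _
    rw [mul_assoc, Equiv.swap_mul_self, mul_one]

theorem specht_apply_ne_zero {v : (Fin n → ℕ) →₀ ℂ}
    (hv : v ∈ (specht (hookPartition n k hk hkn)).toSubmodule) {g : Fin n → ℕ} (h : v g ≠ 0) :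
    ∃ (t : Tableau (hookPartition n k hk hkn)) (π : Equiv.Perm (Fin n)),
      ∀ i, g (π i) = rowOf t i := by
  by_contra hc
  apply h
  clear h
  refine Submodule.span_induction (p := fun v _ => v g = 0) ?_ ?_ ?_ ?_ hv
  · rintro _ ⟨t, rfl⟩
    by_contra h
    exact hc ⟨t, polytabloid_apply_ne_zero t h⟩
  · rfl
  · intro x y _ _ hx hy
    rw [Finsupp.add_apply, hx, hy, add_zero]
  · intro a x _ hx
    rw [Finsupp.smul_apply, hx, smul_zero]

theorem specht_apply_comp {v : (Fin n → ℕ) →₀ ℂ}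
    (hv : v ∈ (specht (hookPartition n k hk hkn)).toSubmodule) (g : Fin n → ℕ)
    (π : Equiv.Perm (Fin n)) (hπ : ∀ i, g i = 0 → π i = i) :
    v (g ∘ π) = ((Equiv.Perm.sign π : ℤ) : ℂ) * v g := by
  refine Submodule.span_induction
    (p := fun v _ => v (g ∘ π) = ((Equiv.Perm.sign π : ℤ) : ℂ) * v g) ?_ ?_ ?_ ?_ hv
  · rintro _ ⟨t, rfl⟩
    exact polytabloid_apply_comp t g π hπ
  · simp
  · intro x y _ _ hx hy
    rw [Finsupp.add_apply, hx, hy, Finsupp.add_apply, mul_add]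
  · intro a x _ hx
    rw [Finsupp.smul_apply, hx, Finsupp.smul_apply, smul_eq_mul, smul_eq_mul, mul_left_comm]

theorem mapDomain_mergeRow_specht {v : (Fin n → ℕ) →₀ ℂ}
    (hv : v ∈ (specht (hookPartition n k hk hkn)).toSubmodule) {r : ℕ}
    (hr : 1 ≤ r) (hr' : r ≤ n - k) : v.mapDomain (mergeRow r) = 0 := by
  refine Submodule.span_induction (p := fun v _ => v.mapDomain (mergeRow r) = 0) ?_ ?_ ?_ ?_ hv
  · rintro _ ⟨t, rfl⟩
    exact mapDomain_mergeRow_polytabloid t hr hr'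
  · simp
  · intro x y _ _ hx hy
    rw [Finsupp.mapDomain_add, hx, hy, add_zero]
  · intro a x _ hx
    rw [Finsupp.mapDomain_smul, hx, smul_zero]

/-- An element of the Specht module of a hook is determined by its coefficients at the tabloids
with `p` in the first row, one for each choice of the set of the remaining rows. -/
theorem specht_eq_zero {v : (Fin n → ℕ) →₀ ℂ}
    (hv : v ∈ (specht (hookPartition n k hk hkn)).toSubmodule) (p : Fin n)
    (h : ∀ I : Finset (Fin n), p ∉ I → I.card = n - k →
      ∃ t : Tableau (hookPartition n k hk hkn), (∀ i, i ∈ I ↔ rowOf t i ≠ 0) ∧ v (rowOf t) = 0) :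
    v = 0 := by
  have hinj : ∀ g, v g ≠ 0 → ∀ x y, g x ≠ 0 → g x = g y → x = y := by
    intro g hg x y hx hxy
    obtain ⟨t, π, hπ⟩ := specht_apply_ne_zero hv hg
    obtain ⟨x, rfl⟩ := π.surjective x
    obtain ⟨y, rfl⟩ := π.surjective y
    rw [hπ, hπ] at hxy
    rw [hπ] at hx
    rw [eq_of_rowOf_eq_of_colOf_eq t hxy
      (by rw [colOf_eq_zero t hx, colOf_eq_zero t (hxy ▸ hx)])]
  have hle : ∀ g, v g ≠ 0 → ∀ x, g x ≤ n - k := by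
    intro g hg x
    obtain ⟨t, π, hπ⟩ := specht_apply_ne_zero hv hg
    obtain ⟨x, rfl⟩ := π.surjective x
    rw [hπ]
    exact rowOf_le t x
  have hsurj : ∀ g, v g ≠ 0 → ∀ r ≤ n - k, ∃ x, g x = r := by
    intro g hg r hr
    obtain ⟨t, π, hπ⟩ := specht_apply_ne_zero hv hg
    obtain ⟨x, hx, -⟩ := exists_rowOf_eq t hr
    exact ⟨π x, by rw [hπ, hx]⟩
  -- A `g` in the support with `p` in its first row has n - k entries below that row, in distinct
  -- rows. It therefore differs from one of the given tabloids only by the permutation `e` of those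
  -- entries, and antisymmetry carries the vanishing over.
  have hzero : ∀ g : Fin n → ℕ, g p = 0 → v g = 0 := by
    intro g hgp
    by_contra hg
    have hbij : Function.Bijective (fun i : {i // i ∈ Finset.univ.filter fun i => g i ≠ 0} =>
        (⟨g i, Finset.mem_Icc.2 ⟨Nat.one_le_iff_ne_zero.2 (Finset.mem_filter.1 i.2).2,
          hle g hg i⟩⟩ : {r // r ∈ Finset.Icc 1 (n - k)})) := by
      constructor
      · rintro ⟨x, hx⟩ ⟨y, hy⟩ hxy
        exact Subtype.ext (hinj g hg x y (Finset.mem_filter.1 hx).2 (congrArg Subtype.val hxy))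
      · rintro ⟨r, hr⟩
        rw [Finset.mem_Icc] at hr
        obtain ⟨x, hx⟩ := hsurj g hg r hr.2
        exact ⟨⟨x, Finset.mem_filter.2 ⟨Finset.mem_univ _, by omega⟩⟩, Subtype.ext hx⟩
    have hcard : (Finset.univ.filter fun i => g i ≠ 0).card = n - k := by
      have := Fintype.card_of_bijective hbij
      rw [Fintype.card_coe, Fintype.card_coe, Nat.card_Icc] at this
      omega
    obtain ⟨t, ht, hvt⟩ := h (Finset.univ.filter fun i => g i ≠ 0) (by simp [hgp]) hcard
    have hbij' : Function.Bijective (fun i : {i // i ∈ Finset.univ.filter fun i => g i ≠ 0} =>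
        (⟨rowOf t i, Finset.mem_Icc.2 ⟨Nat.one_le_iff_ne_zero.2 ((ht _).1 i.2),
          rowOf_le t i⟩⟩ : {r // r ∈ Finset.Icc 1 (n - k)})) := by
      constructor
      · rintro ⟨x, hx⟩ ⟨y, hy⟩ hxy
        have hx' := (ht _).1 hx
        have hy' := (ht _).1 hy
        exact Subtype.ext (eq_of_rowOf_eq_of_colOf_eq t (congrArg Subtype.val hxy)
          (by rw [colOf_eq_zero t hx', colOf_eq_zero t hy']))
      · rintro ⟨r, hr⟩
        rw [Finset.mem_Icc] at hr
        obtain ⟨x, hx, -⟩ := exists_rowOf_eq t hr.2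
        exact ⟨⟨x, (ht _).2 (by omega)⟩, Subtype.ext hx⟩
    let e : Equiv.Perm {i // i ∈ Finset.univ.filter fun i => g i ≠ 0} :=
      (Equiv.ofBijective _ hbij).trans (Equiv.ofBijective _ hbij').symm
    have he : ∀ i, rowOf t (e i) = g i := fun i =>
      congrArg Subtype.val ((Equiv.ofBijective _ hbij').apply_symm_apply
        (Equiv.ofBijective _ hbij i))
    have hg' : g = rowOf t ∘ Equiv.Perm.ofSubtype e := by
      funext i
      by_cases hi : i ∈ Finset.univ.filter fun i => g i ≠ 0
      · rw [Function.comp_apply, Equiv.Perm.ofSubtype_apply_of_mem e hi, he]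
      · rw [Function.comp_apply, Equiv.Perm.ofSubtype_apply_of_not_mem e hi]
        have h1 := not_not.1 (fun h' => hi ((ht i).2 h'))
        rw [h1]
        simpa using hi
    apply hg
    rw [hg', specht_apply_comp hv, hvt, mul_zero]
    intro i hi
    exact Equiv.Perm.ofSubtype_apply_of_not_mem e fun h' => (ht i).1 h' hi
  ext g
  by_contra hg
  rw [Finsupp.zero_apply] at hg
  have hgp : g p ≠ 0 := fun h' => hg (hzero g h')
  -- Merge the row of `p` with the first row and look at the fibre of the merging map through `g`.
  -- Its members with `p` in the first row have coefficient zero by `hzero`; a member of the support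
  -- with `p` elsewhere has `p` in the same row as `g` does, so it equals `g`. The vanishing sum
  -- over the fibre is thus `v g`.
  have h1 := mapDomain_mergeRow_specht hv (Nat.one_le_iff_ne_zero.2 hgp) (hle g hg p)
  have h2 := DFunLike.congr_fun h1 (mergeRow (g p) g)
  rw [Finsupp.mapDomain, Finsupp.sum, Finsupp.finsetSum_apply, Finset.sum_eq_single g] at h2
  · simp only [Finsupp.single_eq_same, Finsupp.zero_apply] at h2
    exact hg h2
  · intro g' hg' hne
    rw [Finsupp.mem_support_iff] at hg'
    rw [Finsupp.single_apply, if_neg]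
    intro heq
    obtain ⟨x, hx⟩ := hsurj g' hg' (g p) (hle g hg p)
    have hp' : g' p ≠ 0 := fun h' => hg' (hzero g' h')
    have hgp' : g' p = g p := by
      have := congrFun heq p
      simp only [mergeRow, if_true] at this
      by_contra h'
      rw [if_neg h'] at this
      exact hp' this
    apply hne
    funext i
    by_cases hi : i = p
    · rw [hi, hgp']
    · have := congrFun heq i
      simp only [mergeRow] at this
      rwa [if_neg, if_neg] at this
      · intro h'
        exact hi (hinj g hg i p (by rwa [h']) h')
      · intro h'
        exact hi (hinj g' hg' i p (by rwa [h']) (h'.trans hgp'.symm))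
  · intro h'
    rw [Finsupp.mem_support_iff, not_not] at h'
    exact absurd h' hg

end Relations

/-! ### The character of a hook -/

/-- The trace of an endomorphism of a space of functions with respect to a basis that is dual to
a family of evaluations. -/
theorem trace_eq_sum_apply {X ι : Type*} [Fintype ι] [DecidableEq ι] {V : Submodule ℂ (X →₀ ℂ)}
    (b : ι → V) (x : ι → X) (hb : ∀ i j, (b i : X →₀ ℂ) (x j) = if i = j then 1 else 0)
    (hV : ∀ v ∈ V, (∀ i, v (x i) = 0) → v = 0) (T : V →ₗ[ℂ] V) :
    LinearMap.trace ℂ V T = ∑ i, (T (b i) : X →₀ ℂ) (x i) := by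
  let e : V →ₗ[ℂ] (ι → ℂ) :=
    { toFun := fun v i => (v : X →₀ ℂ) (x i)
      map_add' := fun v w => rfl
      map_smul' := fun a v => rfl }
  have he : ∀ v i, e v i = (v : X →₀ ℂ) (x i) := fun _ _ => rfl
  have hinj : Function.Injective e := by
    intro v w h
    refine Subtype.ext (sub_eq_zero.1 (hV _ (V.sub_mem v.2 w.2) fun i => ?_))
    rw [Finsupp.sub_apply, ← he, ← he, h, sub_self]
  have hsurj : Function.Surjective e := by
    intro f
    refine ⟨∑ i, f i • b i, ?_⟩
    funext j
    simp [he, hb]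
  let E := LinearEquiv.ofBijective e ⟨hinj, hsurj⟩
  let B := Module.Basis.ofEquivFun E
  have hB : ∀ i, B i = b i := by
    intro i
    apply hinj
    have h : E (B i) = Pi.single i 1 := by
      simp [B]
    change E (B i) = _
    rw [h]
    funext j
    simp [he, hb, Pi.single_apply, eq_comm]
  rw [LinearMap.trace_eq_matrix_trace ℂ B, Matrix.trace]
  refine Finset.sum_congr rfl fun i _ => ?_
  rw [Matrix.diag_apply, LinearMap.toMatrix_apply, hB]
  rfl

/-- The character of a hook at a permutation with a fixed point `p`. -/
theorem irrChar_hookPartition {n k : ℕ} (hk : 1 ≤ k) (hkn : k ≤ n) (σ : Equiv.Perm (Fin n))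
    {p : Fin n} (hσ : σ p = p) :
    irrChar (hookPartition n k hk hkn) σ =
      ∑ I ∈ (Finset.univ.erase p).powersetCard (n - k), restrictSign σ I := by
  have hmem : ∀ I : ↥((Finset.univ.erase p).powersetCard (n - k)),
      p ∉ I.1 ∧ I.1.card = n - k := by
    rintro ⟨I, hI⟩
    rw [Finset.mem_powersetCard] at hI
    exact ⟨fun h => Finset.notMem_erase p _ (hI.1 h), hI.2⟩
  choose t ht1 ht2 ht3 using fun I => exists_tableau hk hkn p _ (hmem I).1 (hmem I).2
  unfold irrChar
  refine (trace_eq_sum_apply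
    (fun I : ↥((Finset.univ.erase p).powersetCard (n - k)) =>
      (⟨polytabloid (t I), Submodule.subset_span ⟨t I, rfl⟩⟩ :
        ↥(specht (hookPartition n k hk hkn)).toSubmodule))
    (fun I => rowOf (t I)) ?_ ?_ _).trans ?_
  · intro I J
    split_ifs with h
    · rw [← h]
      exact polytabloid_apply_rowOf_self (t I) (ht1 I) (ht2 I) (ht3 I)
    · exact polytabloid_apply_rowOf_of_ne (t I) (t J) (ht1 I) (ht2 I) (ht1 J) (ht3 I) (ht3 J)
        ((hmem I).2.trans (hmem J).2.symm) fun h' => h (Subtype.ext h')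
  · intro v hv hz
    refine specht_eq_zero hv p fun I hp hI => ?_
    have hI' : I ∈ (Finset.univ.erase p).powersetCard (n - k) := by
      rw [Finset.mem_powersetCard]
      refine ⟨fun i hi => Finset.mem_erase.2 ⟨?_, Finset.mem_univ _⟩, hI⟩
      rintro rfl
      exact hp hi
    exact ⟨t ⟨I, hI'⟩, ht3 ⟨I, hI'⟩, hz ⟨I, hI'⟩⟩
  · rw [← Finset.sum_coe_sort ((Finset.univ.erase p).powersetCard (n - k))]
    refine Finset.sum_congr rfl fun I _ => ?_
    rw [← polytabloid_apply_rowOf_perm (t I) (ht1 I) (ht2 I) (ht3 I) hσ]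
    change (rowRep n σ (polytabloid (t I))) (rowOf (t I)) = _
    -- The coefficient of σ e_t at f ∘ σ⁻¹ is that of e_t at f, here with f = `rowOf (t I) ∘ σ`.
    have hinj : Function.Injective (fun (f : Fin n → ℕ) (i : Fin n) => f (σ⁻¹ i)) := by
      intro f g h
      funext i
      simpa using congrFun h (σ i)
    have := Finsupp.mapDomain_apply hinj (polytabloid (t I)) (fun i => rowOf (t I) (σ i))
    simpa [rowRep] using this

/-! ### Values of the hook characters -/

theorem restrictSign_eq_sign {n : ℕ} {σ π : Equiv.Perm (Fin n)} {I : Finset (Fin n)}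
    (h1 : ∀ i ∈ I, π i = σ i) (h2 : ∀ i ∉ I, π i = i) :
    restrictSign σ I = ((Equiv.Perm.sign π : ℤ) : ℂ) := by
  rw [restrictSign, Finset.sum_eq_single π]
  · intro τ hτ hne
    exfalso
    apply hne
    obtain ⟨-, h3, h4⟩ := Finset.mem_filter.1 hτ
    ext i
    by_cases hi : i ∈ I
    · rw [h1 i hi, h3 i hi]
    · rw [h2 i hi, h4 i hi]
  · intro h
    exact absurd (Finset.mem_filter.2 ⟨Finset.mem_univ _, h1, h2⟩) h

theorem restrictSign_eq_zero {n : ℕ} {σ : Equiv.Perm (Fin n)} {I : Finset (Fin n)} {i : Fin n}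
    (hi : i ∈ I) (hσi : σ i ∉ I) : restrictSign σ I = 0 := by
  rw [restrictSign, Finset.filter_false_of_mem, Finset.sum_empty]
  rintro π - ⟨h1, h2⟩
  have h3 := h2 _ hσi
  rw [← h1 i hi] at h3 hσi
  rw [π.injective h3] at hσi
  exact hσi hi

theorem exists_perm_eqOn_of_mapsTo {n : ℕ} {σ : Equiv.Perm (Fin n)} {I : Finset (Fin n)}
    (h : ∀ i ∈ I, σ i ∈ I) :
    ∃ π : Equiv.Perm (Fin n), (∀ i ∈ I, π i = σ i) ∧ ∀ i ∉ I, π i = i := by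
  refine ⟨Equiv.Perm.ofSubtype (Equiv.Perm.subtypePermOfFintype σ h), fun i hi => ?_,
    fun i hi => ?_⟩
  · rw [Equiv.Perm.ofSubtype_apply_of_mem _ hi]
    rfl
  · exact Equiv.Perm.ofSubtype_apply_of_not_mem _ hi

/-- For disjoint σ and τ, a set is stable under σ * τ exactly when it is stable under both, and the
induced permutations then multiply. -/
theorem restrictSign_mul {n : ℕ} {σ τ : Equiv.Perm (Fin n)} (h : σ.Disjoint τ)
    (I : Finset (Fin n)) :
    restrictSign (σ * τ) I = restrictSign σ I * restrictSign τ I := by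
  by_cases hσ : ∀ i ∈ I, σ i ∈ I
  · by_cases hτ : ∀ i ∈ I, τ i ∈ I
    · obtain ⟨π, h1, h2⟩ := exists_perm_eqOn_of_mapsTo hσ
      obtain ⟨ρ, h3, h4⟩ := exists_perm_eqOn_of_mapsTo hτ
      rw [restrictSign_eq_sign h1 h2, restrictSign_eq_sign h3 h4,
        restrictSign_eq_sign (π := π * ρ)]
      · rw [Equiv.Perm.sign_mul, Units.val_mul, Int.cast_mul]
      · intro i hi
        rw [Equiv.Perm.mul_apply, Equiv.Perm.mul_apply, h3 i hi, h1 _ (hτ i hi)]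
      · intro i hi
        rw [Equiv.Perm.mul_apply, h4 i hi, h2 i hi]
    · push Not at hτ
      obtain ⟨i, hi, hi'⟩ := hτ
      rw [restrictSign_eq_zero hi hi', mul_zero]
      apply restrictSign_eq_zero hi
      rw [h.commute.eq, Equiv.Perm.mul_apply]
      rcases h i with h | h
      · rwa [h]
      · exact absurd (h.symm ▸ hi) hi'
  · push Not at hσ
    obtain ⟨i, hi, hi'⟩ := hσ
    rw [restrictSign_eq_zero hi hi', zero_mul]
    apply restrictSign_eq_zero hi
    rw [Equiv.Perm.mul_apply]
    rcases h i with h | h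
    · exact absurd (h.symm ▸ hi) hi'
    · rwa [h]

/-- A stable set that meets the support contains the whole orbit, hence the support. A stable set
that misses it is fixed pointwise and contributes the sign 1. -/
theorem restrictSign_isCycle {n : ℕ} {c : Equiv.Perm (Fin n)} (hc : c.IsCycle)
    (I : Finset (Fin n)) :
    restrictSign c I = (if c.support ⊆ I then ((Equiv.Perm.sign c : ℤ) : ℂ) else 0)
      + if Disjoint I c.support then 1 else 0 := by
  by_cases h2 : Disjoint I c.support
  · rw [if_pos h2, if_neg, zero_add, restrictSign_eq_sign (π := 1)]
    · simp
    · intro i hi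
      exact (Equiv.Perm.notMem_support.1 (Finset.disjoint_left.1 h2 hi)).symm
    · intro i _
      rfl
    · intro h
      obtain ⟨x, hx, -⟩ := hc
      have hx := Equiv.Perm.mem_support.2 hx
      exact Finset.disjoint_left.1 h2 (h hx) hx
  · rw [if_neg h2, add_zero]
    split_ifs with h1
    · apply restrictSign_eq_sign (fun _ _ => rfl)
      intro i hi
      exact Equiv.Perm.notMem_support.1 fun h => hi (h1 h)
    · rw [Finset.not_disjoint_iff] at h2
      obtain ⟨x, hxI, hx⟩ := h2
      have hex : ∃ i ∈ I, c i ∉ I := by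
        by_contra hcon
        push Not at hcon
        apply h1
        intro y hy
        obtain ⟨m, rfl⟩ := hc.exists_pow_eq (Equiv.Perm.mem_support.1 hx)
          (Equiv.Perm.mem_support.1 hy)
        clear hy
        induction m with
        | zero => exact hxI
        | succ m ih =>
          rw [pow_succ', Equiv.Perm.mul_apply]
          exact hcon _ ih
      obtain ⟨i, hi, hi'⟩ := hex
      exact restrictSign_eq_zero hi hi'

theorem binom_symm (N : ℕ) (b : ℤ) : binom N (N - b) = binom N b := by
  unfold binom
  split_ifs with h1 h2 h2
  · congr 1
    have : b.toNat ≤ N := by omega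
    rw [← Nat.choose_symm this]
    congr 1
    omega
  · rw [Nat.choose_eq_zero_of_lt (by omega), Nat.cast_zero]
  · rw [Nat.choose_eq_zero_of_lt (by omega), Nat.cast_zero]
  · rfl

/-- Such a set is A together with an arbitrary subset of U \ (A ∪ B) of the complementary size. -/
theorem card_filter_subset_disjoint {α : Type*} [DecidableEq α] {U A B : Finset α} (hA : A ⊆ U)
    (hB : B ⊆ U) (hAB : Disjoint A B) (j : ℕ) :
    (∑ I ∈ U.powersetCard j, if A ⊆ I ∧ Disjoint I B then (1 : ℂ) else 0)
      = binom (U.card - A.card - B.card) ((j : ℤ) - A.card) := by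
  rw [← Finset.sum_filter, Finset.sum_const, nsmul_one]
  unfold binom
  split_ifs with h
  · congr 1
    have hcard : (U \ (A ∪ B)).card = U.card - A.card - B.card := by
      rw [Finset.card_sdiff_of_subset (Finset.union_subset hA hB),
        Finset.card_union_of_disjoint hAB, Nat.sub_add_eq]
    have hj : ((j : ℤ) - A.card).toNat = j - A.card := by omega
    rw [← hcard, hj, ← Finset.card_powersetCard]
    refine Finset.card_bij' (fun I _ => I \ A) (fun J _ => A ∪ J) ?_ ?_ ?_ ?_
    · intro I hI
      obtain ⟨h1, h2, h3⟩ := Finset.mem_filter.1 hI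
      obtain ⟨h4, h5⟩ := Finset.mem_powersetCard.1 h1
      rw [Finset.mem_powersetCard, Finset.card_sdiff_of_subset h2, h5]
      refine ⟨fun x hx => ?_, rfl⟩
      rw [Finset.mem_sdiff] at hx
      rw [Finset.mem_sdiff, Finset.mem_union, not_or]
      exact ⟨h4 hx.1, hx.2, Finset.disjoint_left.1 h3 hx.1⟩
    · intro J hJ
      obtain ⟨h4, h5⟩ := Finset.mem_powersetCard.1 hJ
      rw [Finset.mem_filter, Finset.mem_powersetCard]
      have hAJ : Disjoint A J := Finset.disjoint_right.2 fun x hx hx' =>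
        (Finset.mem_sdiff.1 (h4 hx)).2 (Finset.mem_union_left _ hx')
      refine ⟨⟨Finset.union_subset hA fun x hx => (Finset.mem_sdiff.1 (h4 hx)).1, ?_⟩,
        Finset.subset_union_left, Finset.disjoint_union_left.2 ⟨hAB, ?_⟩⟩
      · rw [Finset.card_union_of_disjoint hAJ, h5]
        omega
      · exact Finset.disjoint_left.2 fun x hx hx' =>
          (Finset.mem_sdiff.1 (h4 hx)).2 (Finset.mem_union_right _ hx')
    · intro I hI
      exact Finset.union_sdiff_of_subset (Finset.mem_filter.1 hI).2.1
    · intro J hJ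
      obtain ⟨h4, -⟩ := Finset.mem_powersetCard.1 hJ
      have hAJ : Disjoint J A := Finset.disjoint_left.2 fun x hx hx' =>
        (Finset.mem_sdiff.1 (h4 hx)).2 (Finset.mem_union_left _ hx')
      exact Finset.union_sdiff_cancel_left hAJ.symm
  · rw [Finset.filter_false_of_mem, Finset.card_empty, Nat.cast_zero]
    rintro I hI ⟨h1, -⟩
    have := Finset.card_le_card h1
    rw [(Finset.mem_powersetCard.1 hI).2] at this
    omega

/-! ### Values at the identity, at cycles and at products of two disjoint cycles -/

section Values

variable {n k : ℕ} (hk : 1 ≤ k) (hkn : k ≤ n)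

/-- In the applications A collects the cycles contained in I and B those avoided by it; N counts the
remaining points other than p. The choice of n - k - |A| of these is turned by symmetry into one of
k - 1 - |B|. -/
theorem card_filter_hook {p : Fin n} {A B : Finset (Fin n)} (hA : p ∉ A) (hB : p ∉ B)
    (hAB : Disjoint A B) (hkn : k ≤ n) {N : ℕ}
    (hN : n = N + 1 + A.card + B.card) :
    (∑ I ∈ (Finset.univ.erase p).powersetCard (n - k),
      if A ⊆ I ∧ Disjoint I B then (1 : ℂ) else 0) = binom N ((k : ℤ) - 1 - B.card) := by
  rw [card_filter_subset_disjoint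
    (Finset.subset_erase.2 ⟨Finset.subset_univ _, hA⟩)
    (Finset.subset_erase.2 ⟨Finset.subset_univ _, hB⟩) hAB,
    Finset.card_erase_of_mem (Finset.mem_univ _), Finset.card_univ, Fintype.card_fin,
    ← binom_symm N]
  congr 1 <;> omega

theorem irrChar_hookPartition_one :
    irrChar (hookPartition n k hk hkn) 1 = binom (n - 1) (k - 1) := by
  obtain ⟨p⟩ : Nonempty (Fin n) := ⟨⟨0, by omega⟩⟩
  rw [irrChar_hookPartition hk hkn 1 (p := p) rfl]
  have h := card_filter_hook (n := n) (k := k) (p := p) (A := ∅) (B := ∅) (by simp) (by simp)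
    (by simp) hkn (N := n - 1) (by simp; omega)
  simp only [Finset.card_empty, Nat.cast_zero, sub_zero] at h
  rw [← h]
  refine Finset.sum_congr rfl fun I _ => ?_
  rw [restrictSign_eq_sign (π := 1) (fun _ _ => rfl) (fun _ _ => rfl)]
  simp

/-- The first term counts, with the sign of σ, the sets that contain the support; the second counts
those that miss it. -/
theorem irrChar_hookPartition_isCycle {σ : Equiv.Perm (Fin n)} (hσ : σ.IsCycle) {N : ℕ}
    (hN : n = N + 1 + σ.support.card) :
    irrChar (hookPartition n k hk hkn) σ =
      ((Equiv.Perm.sign σ : ℤ) : ℂ) * binom N (k - 1) + binom N (k - 1 - σ.support.card) := by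
  obtain ⟨p, hp⟩ : ∃ p, p ∉ σ.support := by
    by_contra h
    push Not at h
    rw [← Finset.eq_univ_iff_forall] at h
    rw [h, Finset.card_univ, Fintype.card_fin] at hN
    omega
  rw [irrChar_hookPartition hk hkn σ (Equiv.Perm.notMem_support.1 hp)]
  have h1 := card_filter_hook (k := k) (p := p) (A := σ.support) (B := ∅) hp (by simp)
    (by simp) hkn (N := N) (by simpa using hN)
  have h2 := card_filter_hook (k := k) (p := p) (A := ∅) (B := σ.support) (by simp) hp
    (by simp) hkn (N := N) (by simpa using hN)
  simp only [Finset.card_empty, Nat.cast_zero, sub_zero] at h1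
  rw [← h1, ← h2, Finset.mul_sum, ← Finset.sum_add_distrib]
  refine Finset.sum_congr rfl fun I _ => ?_
  rw [restrictSign_isCycle hσ]
  simp

/-- The four terms correspond to the sets containing both cycles, c only, d only, and neither. -/
theorem irrChar_hookPartition_mul {c d : Equiv.Perm (Fin n)} (hc : c.IsCycle) (hd : d.IsCycle)
    (hcd : c.Disjoint d) {N : ℕ} (hN : n = N + 1 + c.support.card + d.support.card) :
    irrChar (hookPartition n k hk hkn) (c * d) =
      ((Equiv.Perm.sign c : ℤ) : ℂ) * ((Equiv.Perm.sign d : ℤ) : ℂ) * binom N (k - 1)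
      + ((Equiv.Perm.sign c : ℤ) : ℂ) * binom N (k - 1 - d.support.card)
      + ((Equiv.Perm.sign d : ℤ) : ℂ) * binom N (k - 1 - c.support.card)
      + binom N (k - 1 - (c.support.card + d.support.card)) := by
  have hdis := hcd.disjoint_support
  have hcard := Finset.card_union_of_disjoint hdis
  obtain ⟨p, hp⟩ : ∃ p, p ∉ c.support ∪ d.support := by
    by_contra h
    push Not at h
    rw [← Finset.eq_univ_iff_forall] at h
    rw [h, Finset.card_univ, Fintype.card_fin] at hcard
    omega
  have hpc : p ∉ c.support := fun h => hp (Finset.mem_union_left _ h)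
  have hpd : p ∉ d.support := fun h => hp (Finset.mem_union_right _ h)
  have hσp : (c * d) p = p := by
    rw [Equiv.Perm.mul_apply, Equiv.Perm.notMem_support.1 hpd, Equiv.Perm.notMem_support.1 hpc]
  rw [irrChar_hookPartition hk hkn _ hσp]
  have h1 := card_filter_hook (k := k) (p := p) (A := c.support ∪ d.support) (B := ∅) hp
    (by simp) (by simp) hkn (N := N) (by rw [hcard]; simpa [add_assoc] using hN)
  have h2 := card_filter_hook (k := k) (p := p) (A := ∅) (B := c.support ∪ d.support) (by simp)
    hp (by simp) hkn (N := N) (by rw [hcard]; simpa [add_assoc] using hN)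
  have h3 := card_filter_hook (k := k) (p := p) (A := c.support) (B := d.support) hpc hpd
    hdis hkn (N := N) hN
  have h4 := card_filter_hook (k := k) (p := p) (A := d.support) (B := c.support) hpd hpc
    hdis.symm hkn (N := N) (by omega)
  simp only [Finset.card_empty, Nat.cast_zero, sub_zero] at h1
  rw [hcard, Nat.cast_add] at h2
  rw [← h1, ← h2, ← h3, ← h4, Finset.mul_sum, Finset.mul_sum, Finset.mul_sum,
    ← Finset.sum_add_distrib, ← Finset.sum_add_distrib, ← Finset.sum_add_distrib]
  refine Finset.sum_congr rfl fun I _ => ?_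
  rw [restrictSign_mul hcd, restrictSign_isCycle hc, restrictSign_isCycle hd]
  simp only [Finset.union_subset_iff, Finset.disjoint_union_right, Finset.disjoint_empty_right,
    Finset.empty_subset, true_and, and_true]
  by_cases a1 : c.support ⊆ I <;> by_cases a2 : Disjoint I c.support <;>
    by_cases a3 : d.support ⊆ I <;> by_cases a4 : Disjoint I d.support <;>
    simp [a1, a2, a3, a4] <;> ring

end Values

/-- The right side is the form in which the character of a transposition arises. For k ≥ 2 the
identity combines Pascal's rule with (b+1)·C(a,b+1) = (a-b)·C(a,b) for a = n-2 and b = k-2; for k =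
1 both sides are -1. -/
theorem swapValue_eq {n k : ℕ} (hk : 1 ≤ k) (hkn : k ≤ n) (hn : 3 ≤ n) :
    swapValue n k = binom (n - 3) (k - 3) - binom (n - 3) (k - 1) := by
  obtain ⟨N, rfl⟩ := Nat.exists_eq_add_of_le' hn
  obtain ⟨K, rfl⟩ := Nat.exists_eq_add_of_le' hk
  have e1 : N + 3 - 3 = N := by omega
  have e2 : N + 3 - 2 = N + 1 := by omega
  have e3 : ((K + 1 : ℕ) : ℤ) - 1 = (K : ℕ) := by push_cast; ring
  unfold swapValue
  rw [e1, e2, e3]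
  rcases K with _ | K
  · simp [binom]
  · have hK : K + 1 + 1 ≠ 1 := by omega
    rw [if_neg hK]
    have e4 : ((K + 1 + 1 : ℕ) : ℤ) - 2 = (K : ℕ) := by push_cast; ring
    rw [e4]
    have hb : ∀ a b : ℕ, binom a (b : ℤ) = (a.choose b : ℂ) := by
      intro a b
      simp [binom]
    have h1 : (((N + 1).choose (K + 1) : ℕ) : ℂ) * ((K : ℂ) + 1)
        = ((N + 1).choose K : ℕ) * ((N : ℂ) + 1 - K) := by
      have h := Nat.choose_succ_right_eq (N + 1) K
      have hle : K ≤ N + 1 := by omega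
      have := congrArg (Nat.cast : ℕ → ℂ) h
      rw [Nat.cast_mul, Nat.cast_mul, Nat.cast_sub hle] at this
      push_cast at this
      exact this
    have h2 : (((N + 1).choose (K + 1) : ℕ) : ℂ) = (N.choose K : ℕ) + (N.choose (K + 1) : ℕ) := by
      rw [Nat.choose_succ_succ]
      push_cast
      rfl
    have h3 : binom N (((K + 1 + 1 : ℕ) : ℤ) - 3)
        = (((N + 1).choose K : ℕ) : ℂ) - (N.choose K : ℕ) := by
      rcases K with _ | K
      · simp [binom]
      · have e5 : ((K + 1 + 1 + 1 : ℕ) : ℤ) - 3 = (K : ℕ) := by push_cast; ring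
        rw [e5, hb, Nat.choose_succ_succ]
        push_cast
        ring
    rw [h3, hb, hb]
    have hne : (K : ℂ) + 1 ≠ 0 := Nat.cast_add_one_ne_zero K
    push_cast
    rw [add_sub_cancel_right, div_mul_eq_mul_div, div_eq_iff hne]
    rw [h2] at h1
    linear_combination h1

/-! ### Coefficients of immanantal polynomials -/

/-- S is the set of positions at which the factor is taken from -M. At every other position the
factor comes from xI, which is nonzero only at points fixed by σ. -/
theorem prod_smul_one_sub_map {n : ℕ} (M : Matrix (Fin n) (Fin n) ℂ) (σ : Equiv.Perm (Fin n)) :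
    ∏ i, ((X : ℂ[X]) • (1 : Matrix (Fin n) (Fin n) ℂ[X]) - M.map C) i (σ i) =
      ∑ S : Finset (Fin n) with σ.support ⊆ S,
        C ((-1) ^ S.card * ∏ i ∈ S, M i (σ i)) * X ^ (n - S.card) := by
  have h : ∀ i, ((X : ℂ[X]) • (1 : Matrix (Fin n) (Fin n) ℂ[X]) - M.map C) i (σ i)
      = C (-M i (σ i)) + if σ i = i then X else 0 := by
    intro i
    simp only [Matrix.sub_apply, Matrix.smul_apply, Matrix.one_apply, Matrix.map_apply,
      smul_eq_mul, mul_ite, mul_one, mul_zero, C_neg, eq_comm (a := i)]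
    ring
  rw [Finset.prod_congr rfl fun i _ => h i, Finset.prod_add, Finset.powerset_univ,
    Finset.sum_filter]
  refine Finset.sum_congr rfl fun S _ => ?_
  split_ifs with hS
  · have h1 : ∀ i ∈ Finset.univ \ S, (if σ i = i then (X : ℂ[X]) else 0) = X := by
      intro i hi
      rw [if_pos]
      exact Equiv.Perm.notMem_support.1 fun h' => (Finset.mem_sdiff.1 hi).2 (hS h')
    rw [Finset.prod_congr rfl h1, Finset.prod_const, ← map_prod, Finset.prod_neg,
      ← Finset.compl_eq_univ_sdiff, Finset.card_compl, Fintype.card_fin]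
  · rw [Finset.not_subset] at hS
    obtain ⟨i, hi, hiS⟩ := hS
    rw [Finset.prod_eq_zero (i := i) (Finset.mem_sdiff.2 ⟨Finset.mem_univ _, hiS⟩), mul_zero]
    rw [if_neg (Equiv.Perm.mem_support.1 hi)]

theorem immPoly_eq_sum {n : ℕ} (lam : n.Partition) (M : Matrix (Fin n) (Fin n) ℂ) :
    immPoly lam M = ∑ r ∈ Finset.range (n + 1), C ((-1) ^ r * ∑ σ : Equiv.Perm (Fin n),
      irrChar lam σ * ∑ S ∈ Finset.univ.powersetCard r with σ.support ⊆ S,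
        ∏ i ∈ S, M i (σ i)) * X ^ (n - r) := by
  unfold immPoly immanant
  simp only [Finset.mul_sum, map_sum, Finset.sum_mul]
  rw [Finset.sum_comm]
  refine Finset.sum_congr rfl fun σ _ => ?_
  rw [prod_smul_one_sub_map, Finset.smul_sum, Finset.sum_filter, ← Finset.powerset_univ,
    Finset.sum_powerset, Finset.card_univ, Fintype.card_fin]
  refine Finset.sum_congr rfl fun r _ => ?_
  rw [Finset.sum_filter]
  refine Finset.sum_congr rfl fun S hS => ?_
  rw [(Finset.mem_powersetCard.1 hS).2]
  split_ifs
  · rw [smul_eq_C_mul, ← mul_assoc, ← C_mul]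
    congr 2
    ring
  · rfl

theorem immCoeff_eq_sum {n : ℕ} (lam : n.Partition) (M : Matrix (Fin n) (Fin n) ℂ) {r : ℕ}
    (hr : r ≤ n) :
    immCoeff lam r M = ∑ σ : Equiv.Perm (Fin n),
      irrChar lam σ * ∑ S ∈ Finset.univ.powersetCard r with σ.support ⊆ S,
        ∏ i ∈ S, M i (σ i) := by
  unfold immCoeff
  rw [immPoly_eq_sum, finsetSum_coeff, Finset.sum_eq_single r]
  · rw [coeff_C_mul_X_pow, if_pos rfl, ← mul_assoc, ← mul_pow]
    simp
  · intro s hs hne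
    rw [coeff_C_mul_X_pow, if_neg]
    -- Since r and s are at most n, the truncated differences n - r and n - s agree only if r = s.
    have := Finset.mem_range.1 hs
    omega
  · intro h
    exact absurd (Finset.mem_range.2 (by omega)) h

theorem immPoly_eq_sum_immCoeff {n : ℕ} (lam : n.Partition) (M : Matrix (Fin n) (Fin n) ℂ) :
    immPoly lam M
      = ∑ r ∈ Finset.range (n + 1), C ((-1) ^ r * immCoeff lam r M) * X ^ (n - r) := by
  conv_lhs => rw [immPoly_eq_sum]
  refine Finset.sum_congr rfl fun r hr => ?_
  rw [immCoeff_eq_sum lam M (Nat.lt_succ_iff.1 (Finset.mem_range.1 hr))]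

/-! ### Coefficients for the matrix βD + γA -/

section Graph

variable {n : ℕ} (G : SimpleGraph (Fin n)) [DecidableRel G.Adj]

/-- The permutations with `s` non-fixed points that move each vertex to itself or to a
neighbor. -/
def graphPerms (s : ℕ) : Finset (Equiv.Perm (Fin n)) :=
  {σ | (∀ i ∈ σ.support, G.Adj i (σ i)) ∧ σ.support.card = s}

variable {G} in
theorem mem_graphPerms {s : ℕ} {σ : Equiv.Perm (Fin n)} :
    σ ∈ graphPerms G s ↔ (∀ i ∈ σ.support, G.Adj i (σ i)) ∧ σ.support.card = s := by
  simp [graphPerms]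

theorem degEsymm_eq_sum (S : Finset (Fin n)) (r : ℕ) :
    (degEsymm G S r : ℂ) = ∑ T ∈ S.powersetCard r, ∏ v ∈ T, (G.degree v : ℂ) := by
  unfold degEsymm
  rw [Finset.esymm_map_val]
  push_cast
  rfl

@[simp]
theorem degEsymm_zero (S : Finset (Fin n)) : degEsymm G S 0 = 1 := by
  unfold degEsymm
  rw [Finset.esymm_map_val]
  simp

/-- Write S as the support of σ together with a set T of fixed points. The support contributes γ at
each vertex sent to a neighbor and 0 at any other, while each v in T contributes β d(v); summing
over T gives the elementary symmetric function. -/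
theorem sum_prod_linComb (β γ : ℝ) (σ : Equiv.Perm (Fin n)) (r : ℕ) :
    ∑ S ∈ Finset.univ.powersetCard r with σ.support ⊆ S, ∏ i ∈ S, linComb G β γ i (σ i) =
      if (∀ i ∈ σ.support, G.Adj i (σ i)) ∧ σ.support.card ≤ r then
        (γ : ℂ) ^ σ.support.card * (β : ℂ) ^ (r - σ.support.card) *
          degEsymm G σ.supportᶜ (r - σ.support.card)
      else 0 := by
  have hdiag : ∀ i ∉ σ.support, linComb G β γ i (σ i) = β * G.degree i := by
    intro i hi
    rw [Equiv.Perm.notMem_support.1 hi]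
    simp [linComb, SimpleGraph.degMatrix]
  have hoff : ∀ i ∈ σ.support, linComb G β γ i (σ i) = if G.Adj i (σ i) then (γ : ℂ) else 0 := by
    intro i hi
    have := (Equiv.Perm.mem_support.1 hi).symm
    simp [linComb, SimpleGraph.degMatrix, Matrix.diagonal_apply_ne _ this]
  split_ifs with h
  · obtain ⟨h1, h2⟩ := h
    rw [degEsymm_eq_sum, Finset.mul_sum]
    refine Finset.sum_bij' (fun S _ => S \ σ.support) (fun T _ => σ.support ∪ T) ?_ ?_ ?_ ?_ ?_
    · intro S hS
      obtain ⟨h3, h4⟩ := Finset.mem_filter.1 hS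
      rw [Finset.mem_powersetCard, Finset.card_sdiff_of_subset h4,
        (Finset.mem_powersetCard.1 h3).2]
      refine ⟨fun x hx => Finset.mem_compl.2 (Finset.mem_sdiff.1 hx).2, rfl⟩
    · intro T hT
      obtain ⟨h3, h4⟩ := Finset.mem_powersetCard.1 hT
      have hd : Disjoint σ.support T :=
        Finset.disjoint_right.2 fun x hx => Finset.mem_compl.1 (h3 hx)
      rw [Finset.mem_filter, Finset.mem_powersetCard, Finset.card_union_of_disjoint hd, h4]
      exact ⟨⟨Finset.subset_univ _, by omega⟩, Finset.subset_union_left⟩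
    · intro S hS
      exact Finset.union_sdiff_of_subset (Finset.mem_filter.1 hS).2
    · intro T hT
      have hd : Disjoint σ.support T := Finset.disjoint_right.2 fun x hx =>
        Finset.mem_compl.1 ((Finset.mem_powersetCard.1 hT).1 hx)
      exact Finset.union_sdiff_cancel_left hd
    · intro S hS
      obtain ⟨h3, h4⟩ := Finset.mem_filter.1 hS
      have hc : (S \ σ.support).card = r - σ.support.card := by
        rw [Finset.card_sdiff_of_subset h4, (Finset.mem_powersetCard.1 h3).2]
      rw [← Finset.prod_sdiff h4, Finset.prod_congr rfl fun i hi =>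
        hdiag i (Finset.mem_sdiff.1 hi).2, Finset.prod_mul_distrib, Finset.prod_const, hc,
        Finset.prod_congr rfl fun i hi => (hoff i hi).trans (if_pos (h1 i hi)),
        Finset.prod_const]
      ring
  · apply Finset.sum_eq_zero
    intro S hS
    obtain ⟨h3, h4⟩ := Finset.mem_filter.1 hS
    have hc := Finset.card_le_card h4
    rw [(Finset.mem_powersetCard.1 h3).2] at hc
    have h5 : ∃ i ∈ σ.support, ¬ G.Adj i (σ i) := by
      by_contra hcon
      push Not at hcon
      exact h ⟨hcon, hc⟩
    obtain ⟨i, hi, hadj⟩ := h5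
    exact Finset.prod_eq_zero (h4 hi) ((hoff i hi).trans (if_neg hadj))

/-- The coefficients of the immanantal polynomial of `β D(G) + γ A(G)`, as sums over the
permutations that move vertices to neighbors. -/
theorem immCoeff_linComb (lam : n.Partition) (β γ : ℝ) {r : ℕ} (hr : r ≤ n) :
    immCoeff lam r (linComb G β γ) = ∑ s ∈ Finset.range (r + 1),
      (γ : ℂ) ^ s * (β : ℂ) ^ (r - s) *
        ∑ σ ∈ graphPerms G s, irrChar lam σ * degEsymm G σ.supportᶜ (r - s) := by
  rw [immCoeff_eq_sum lam _ hr]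
  simp only [sum_prod_linComb, mul_ite, mul_zero]
  rw [← Finset.sum_filter, ← Finset.sum_fiberwise_of_maps_to
    (t := Finset.range (r + 1)) (g := fun σ : Equiv.Perm (Fin n) => σ.support.card)]
  · refine Finset.sum_congr rfl fun s hs => ?_
    rw [Finset.mul_sum]
    refine Finset.sum_congr ?_ ?_
    · ext σ
      rw [Finset.mem_filter, Finset.mem_filter, mem_graphPerms]
      have := Finset.mem_range.1 hs
      constructor
      · rintro ⟨⟨-, h1, -⟩, h2⟩
        exact ⟨h1, h2⟩
      · rintro ⟨h1, h2⟩
        exact ⟨⟨Finset.mem_univ _, h1, by omega⟩, h2⟩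
    · intro σ hσ
      rw [(mem_graphPerms.1 hσ).2]
      ring
  · intro σ hσ
    exact Finset.mem_range.2 (Nat.lt_succ_of_le (Finset.mem_filter.1 hσ).2.2)

end Graph

/-! ### Involutions and matchings -/

section Graph

variable {n : ℕ} (G : SimpleGraph (Fin n)) [DecidableRel G.Adj]

/-- The pairs `{i, σ i}` of a permutation `σ`, for `i` not fixed by `σ`. -/
def edgesOf (σ : Equiv.Perm (Fin n)) : Finset (Sym2 (Fin n)) :=
  σ.support.image fun i => s(i, σ i)

section Involution

variable {σ τ : Equiv.Perm (Fin n)}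

theorem eq_mk_of_mem_edgesOf (hσ : ∀ i, σ (σ i) = i) {e : Sym2 (Fin n)} (he : e ∈ edgesOf σ)
    {v : Fin n} (hv : v ∈ e) : v ∈ σ.support ∧ e = s(v, σ v) := by
  obtain ⟨i, hi, rfl⟩ := Finset.mem_image.1 he
  rcases Sym2.mem_iff.1 hv with rfl | rfl
  · exact ⟨hi, rfl⟩
  · rw [hσ]
    exact ⟨Equiv.Perm.apply_mem_support.2 hi, Sym2.eq_swap⟩

theorem covered_edgesOf (hσ : ∀ i, σ (σ i) = i) : covered (edgesOf σ) = σ.support := by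
  ext v
  simp only [covered, Finset.mem_filter, Finset.mem_univ, true_and]
  constructor
  · rintro ⟨e, he, hv⟩
    exact (eq_mk_of_mem_edgesOf hσ he hv).1
  · intro hv
    exact ⟨s(v, σ v), Finset.mem_image_of_mem _ hv, Sym2.mem_mk_left _ _⟩

theorem card_support_eq_two_mul (hσ : ∀ i, σ (σ i) = i) :
    σ.support.card = 2 * (edgesOf σ).card := by
  rw [Finset.card_eq_sum_card_image (fun i => s(i, σ i)) σ.support, mul_comm]
  apply Finset.sum_const_nat
  intro e he
  obtain ⟨i, hi, rfl⟩ := Finset.mem_image.1 he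
  have h : (σ.support.filter fun a => s(a, σ a) = s(i, σ i)) = {i, σ i} := by
    ext a
    simp only [Finset.mem_filter, Finset.mem_insert, Finset.mem_singleton]
    constructor
    · rintro ⟨-, ha⟩
      have : a ∈ s(i, σ i) := ha ▸ Sym2.mem_mk_left _ _
      exact Sym2.mem_iff.1 this
    · rintro (rfl | rfl)
      · exact ⟨hi, rfl⟩
      · rw [hσ]
        exact ⟨Equiv.Perm.apply_mem_support.2 hi, Sym2.eq_swap⟩
  rw [h, Finset.card_pair (Equiv.Perm.mem_support.1 hi).symm]

theorem eq_of_edgesOf_eq (hσ : ∀ i, σ (σ i) = i) (hτ : ∀ i, τ (τ i) = i)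
    (h : edgesOf σ = edgesOf τ) : σ = τ := by
  have hs : σ.support = τ.support := by rw [← covered_edgesOf hσ, h, covered_edgesOf hτ]
  ext i
  by_cases hi : i ∈ σ.support
  · have he : s(i, σ i) ∈ edgesOf τ := h ▸ Finset.mem_image_of_mem _ hi
    have := (eq_mk_of_mem_edgesOf hτ he (Sym2.mem_mk_left _ _)).2
    rw [Sym2.congr_right.1 this]
  · rw [Equiv.Perm.notMem_support.1 hi, Equiv.Perm.notMem_support.1 (hs ▸ hi)]

end Involution

/-- The involution exchanges the ends of each edge of E and fixes the uncovered vertices; it is well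
defined because the edges are disjoint. -/
theorem exists_edgesOf_eq {l : ℕ} {E : Finset (Sym2 (Fin n))} (hE : E ∈ matchings G l) :
    ∃ σ : Equiv.Perm (Fin n), (∀ i, σ (σ i) = i) ∧ edgesOf σ = E := by
  classical
  obtain ⟨hE1, hE2⟩ := Finset.mem_filter.1 hE
  obtain ⟨hE3, -⟩ := Finset.mem_powersetCard.1 hE1
  let f : Fin n → Fin n := fun v =>
    if h : ∃ e, e ∈ E ∧ v ∈ e then Sym2.Mem.other h.choose_spec.2 else v
  have hf : ∀ e ∈ E, ∀ v ∈ e, e = s(v, f v) := by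
    intro e he v hv
    have h : ∃ e, e ∈ E ∧ v ∈ e := ⟨e, he, hv⟩
    have h1 : e = h.choose := by
      by_contra hne
      exact hE2 e he _ h.choose_spec.1 hne v ⟨hv, h.choose_spec.2⟩
    have h2 : f v = Sym2.Mem.other h.choose_spec.2 := dif_pos h
    rw [h2, Sym2.other_spec h.choose_spec.2]
    exact h1
  have hf' : ∀ v, (¬ ∃ e, e ∈ E ∧ v ∈ e) → f v = v := fun v h => dif_neg h
  have hinv : Function.Involutive f := by
    intro v
    by_cases h : ∃ e, e ∈ E ∧ v ∈ e
    · obtain ⟨e, he, hv⟩ := h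
      have h1 := hf e he v hv
      have h2 := hf e he (f v) (h1 ▸ Sym2.mem_mk_right _ _)
      rw [h1, Sym2.eq_swap] at h2
      exact (Sym2.congr_right.1 h2).symm
    · rw [hf' v h, hf' v h]
  refine ⟨hinv.toPerm, hinv, ?_⟩
  ext e
  simp only [edgesOf, Finset.mem_image, Equiv.Perm.mem_support, Function.Involutive.coe_toPerm]
  constructor
  · rintro ⟨v, hv, rfl⟩
    by_cases h : ∃ e, e ∈ E ∧ v ∈ e
    · obtain ⟨e, he, hv⟩ := h
      rwa [← hf e he v hv]
    · exact absurd (hf' v h) hv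
  · intro he
    induction e with
    | h v w =>
      have h1 := hf _ he v (Sym2.mem_mk_left _ _)
      refine ⟨v, fun h2 => ?_, h1.symm⟩
      have h3 := SimpleGraph.mem_edgeFinset.1 (hE3 he)
      rw [Sym2.congr_right.1 h1, h2] at h3
      exact G.loopless.irrefl v h3

/-- Summing over the involutions that move vertices to neighbors amounts to summing over
matchings. -/
theorem sum_involutions_eq_sum_matchings (l : ℕ) (g : Finset (Fin n) → ℂ) :
    ∑ σ ∈ graphPerms G (2 * l) with ∀ i, σ (σ i) = i, g σ.support
      = ∑ E ∈ matchings G l, g (covered E) := by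
  refine Finset.sum_bij (fun σ _ => edgesOf σ) ?_ ?_ ?_ ?_
  · intro σ hσ
    obtain ⟨h1, h2⟩ := Finset.mem_filter.1 hσ
    obtain ⟨h3, h4⟩ := mem_graphPerms.1 h1
    refine Finset.mem_filter.2 ⟨Finset.mem_powersetCard.2 ⟨?_, ?_⟩, ?_⟩
    · intro e he
      obtain ⟨i, hi, rfl⟩ := Finset.mem_image.1 he
      exact SimpleGraph.mem_edgeFinset.2 (h3 i hi)
    · have := card_support_eq_two_mul h2
      omega
    · rintro e he f hf hne v ⟨hve, hvf⟩
      exact hne ((eq_mk_of_mem_edgesOf h2 he hve).2.trans (eq_mk_of_mem_edgesOf h2 hf hvf).2.symm)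
  · intro σ hσ τ hτ h
    exact eq_of_edgesOf_eq (Finset.mem_filter.1 hσ).2 (Finset.mem_filter.1 hτ).2 h
  · intro E hE
    obtain ⟨σ, h1, rfl⟩ := exists_edgesOf_eq G hE
    obtain ⟨h2, h3⟩ := Finset.mem_powersetCard.1 (Finset.mem_filter.1 hE).1
    refine ⟨σ, Finset.mem_filter.2 ⟨mem_graphPerms.2 ⟨fun i hi => ?_, ?_⟩, h1⟩, rfl⟩
    · exact SimpleGraph.mem_edgeFinset.1 (h2 (Finset.mem_image_of_mem _ hi))
    · rw [card_support_eq_two_mul h1, h3]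
  · intro σ hσ
    rw [covered_edgesOf (Finset.mem_filter.1 hσ).2]

theorem matchings_one : matchings G 1 = G.edgeFinset.powersetCard 1 := by
  refine Finset.filter_true_of_mem fun E hE => ?_
  obtain ⟨-, h2⟩ := Finset.mem_powersetCard.1 hE
  obtain ⟨e, rfl⟩ := Finset.card_eq_one.1 h2
  intro f hf f' hf' hne
  rw [Finset.mem_singleton] at hf hf'
  exact absurd (hf.trans hf'.symm) hne

theorem card_matchings_one : (matchings G 1).card = G.edgeFinset.card := by
  rw [matchings_one, Finset.card_powersetCard, Nat.choose_one_right]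

/-- The number of pairs of disjoint edges. -/
theorem card_matchings_two :
    (matchings G 2).card + ∑ v, (G.degree v).choose 2 = G.edgeFinset.card.choose 2 := by
  classical
  -- Two distinct edges share at most one vertex, so each intersecting pair is counted exactly once,
  -- at its common vertex.
  have h : ∑ v, (G.degree v).choose 2
      = (Finset.univ.biUnion fun v => (G.incidenceFinset v).powersetCard 2).card := by
    rw [Finset.card_biUnion]
    · simp
    · intro v _ w _ hvw
      rw [Function.onFun, Finset.disjoint_left]
      intro T hT hT'
      obtain ⟨h1, h2⟩ := Finset.mem_powersetCard.1 hT
      obtain ⟨h1', -⟩ := Finset.mem_powersetCard.1 hT'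
      obtain ⟨e, f, hef, rfl⟩ := Finset.card_eq_two.1 h2
      have key : ∀ d ∈ ({e, f} : Finset (Sym2 (Fin n))), d = s(v, w) := by
        intro d hd
        exact (Sym2.mem_and_mem_iff hvw).1
          ⟨((G.mem_incidenceFinset v d).1 (h1 hd)).2, ((G.mem_incidenceFinset w d).1 (h1' hd)).2⟩
      exact hef ((key e (by simp)).trans (key f (by simp)).symm)
  have hunion : (Finset.univ.biUnion fun v => (G.incidenceFinset v).powersetCard 2)
      = {E ∈ G.edgeFinset.powersetCard 2 |
          ¬ ∀ e ∈ E, ∀ f ∈ E, e ≠ f → ∀ v, ¬ (v ∈ e ∧ v ∈ f)} := by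
    ext E
    simp only [Finset.mem_biUnion, Finset.mem_univ, true_and, Finset.mem_filter,
      Finset.mem_powersetCard]
    constructor
    · rintro ⟨v, h1, h2⟩
      refine ⟨⟨h1.trans (G.incidenceFinset_subset v), h2⟩, fun hcon => ?_⟩
      obtain ⟨e, f, hef, rfl⟩ := Finset.card_eq_two.1 h2
      exact hcon e (by simp) f (by simp) hef v
        ⟨((G.mem_incidenceFinset v e).1 (h1 (by simp))).2,
          ((G.mem_incidenceFinset v f).1 (h1 (by simp))).2⟩
    · rintro ⟨⟨h1, h2⟩, hcon⟩
      push Not at hcon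
      obtain ⟨e, he, f, hf, hef, v, hve, hvf⟩ := hcon
      have hE : E = {e, f} := by
        symm
        apply Finset.eq_of_subset_of_card_le
        · intro d hd
          rw [Finset.mem_insert, Finset.mem_singleton] at hd
          rcases hd with rfl | rfl <;> assumption
        · rw [h2, Finset.card_pair hef]
      refine ⟨v, fun d hd => ?_, h2⟩
      rw [G.mem_incidenceFinset]
      refine ⟨SimpleGraph.mem_edgeFinset.1 (h1 hd), ?_⟩
      rw [hE, Finset.mem_insert, Finset.mem_singleton] at hd
      rcases hd with rfl | rfl <;> assumption
  rw [h, hunion, ← Finset.card_powersetCard]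
  unfold matchings
  convert Finset.card_filter_add_card_filter_not _ using 2

/-- The number of edges that avoid a triangle. -/
theorem card_filter_edgeFinset_triangle {a b c : Fin n} (hab : G.Adj a b) (hbc : G.Adj b c)
    (hca : G.Adj c a) :
    (G.edgeFinset.filter fun e => ∀ v ∈ ({a, b, c} : Finset (Fin n)), v ∉ e).card
      + ∑ v ∈ ({a, b, c} : Finset (Fin n)), G.degree v = G.edgeFinset.card + 3 := by
  classical
  have h1 : ∀ v, G.degree v = ∑ e ∈ G.edgeFinset, if v ∈ e then 1 else 0 := by
    intro v
    rw [← G.card_incidenceFinset_eq_degree, G.incidenceFinset_eq_filter, Finset.card_filter]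
  have h2 : ∑ e ∈ G.edgeFinset, (if e ∈ ({s(a, b), s(b, c), s(c, a)} : Finset (Sym2 (Fin n)))
      then 1 else 0) = 3 := by
    rw [← Finset.card_filter, Finset.filter_mem_eq_inter, Finset.inter_eq_right.2]
    · have hab' := hab.ne
      have hbc' := hbc.ne
      have hca' := hca.ne
      rw [Finset.card_eq_three]
      refine ⟨_, _, _, ?_, ?_, ?_, rfl⟩ <;> simp <;> tauto
    · intro e he
      simp only [Finset.mem_insert, Finset.mem_singleton] at he
      rcases he with rfl | rfl | rfl <;> exact SimpleGraph.mem_edgeFinset.2 (by assumption)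
  -- An edge has 0, 1 or 2 ends on the triangle, and 2 only if it is one of the triangle's edges.
  -- Summing this identity over all edges gives the count.
  have h3 : ∀ e ∈ G.edgeFinset,
      ((if ∀ v ∈ ({a, b, c} : Finset (Fin n)), v ∉ e then 1 else 0)
        + ∑ v ∈ ({a, b, c} : Finset (Fin n)), if v ∈ e then 1 else 0)
      = 1 + if e ∈ ({s(a, b), s(b, c), s(c, a)} : Finset (Sym2 (Fin n))) then 1 else 0 := by
    intro e he
    have hab' := hab.ne
    have hbc' := hbc.ne
    have hca' := hca.ne
    rw [Finset.sum_insert (by simp [hab', hca'.symm]), Finset.sum_pair hbc']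
    induction e with
    | h x y =>
      have hxy : x ≠ y := (SimpleGraph.mem_edgeFinset.1 he : G.Adj x y).ne
      simp only [Finset.mem_insert, Finset.mem_singleton, forall_eq_or_imp, forall_eq,
        Sym2.mem_iff, Sym2.eq_iff]
      split_ifs <;> first | rfl | (exfalso; grind)
  simp only [h1]
  rw [Finset.sum_comm, Finset.card_filter, ← Finset.sum_add_distrib, Finset.sum_congr rfl h3,
    Finset.sum_add_distrib, h2]
  simp

end Graph

/-! ### Cyclic permutations and cycles of a graph -/

section Graph

variable {n : ℕ} (G : SimpleGraph (Fin n))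

/-- The subgraph of `G` formed by the edges `{i, σ i}` of `G` with `i` not fixed by `σ`. -/
def orbitSubgraph (σ : Equiv.Perm (Fin n)) : G.Subgraph where
  verts := {v | v ∈ σ.support}
  Adj u v := G.Adj u v ∧ u ∈ σ.support ∧ (σ u = v ∨ σ v = u)
  adj_sub h := h.1
  edge_vert h := h.2.1
  symm := by
    constructor
    rintro u v ⟨h1, h2, h3⟩
    refine ⟨h1.symm, ?_, h3.symm⟩
    rcases h3 with rfl | rfl
    · exact Equiv.Perm.apply_mem_support.2 h2
    · exact Equiv.Perm.apply_mem_support.1 h2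

theorem vertsOf_orbitSubgraph (σ : Equiv.Perm (Fin n)) :
    vertsOf G (orbitSubgraph G σ) = σ.support := by
  ext v
  simp [vertsOf, orbitSubgraph]

theorem orbitSubgraph_inv (σ : Equiv.Perm (Fin n)) :
    orbitSubgraph G σ⁻¹ = orbitSubgraph G σ := by
  ext u v
  · simp [orbitSubgraph]
  · simp only [orbitSubgraph, Equiv.Perm.support_inv, Equiv.Perm.inv_eq_iff_eq]
    tauto

variable {G}

/-- At each vertex τ goes along σ or against it. If it goes along at y and against at σ y, then τ²
fixes y, which is impossible for a cycle of length at least 3. So the direction chosen at one vertex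
propagates around the whole cycle. -/
theorem IsCycle.eq_or_eq_inv_of_forall {σ τ : Equiv.Perm (Fin n)} (hσ : σ.IsCycle)
    (hτ : τ.IsCycle) (hs : σ.support = τ.support) (h3 : 3 ≤ σ.support.card)
    (h : ∀ i ∈ σ.support, τ i = σ i ∨ σ (τ i) = i) : τ = σ ∨ τ = σ⁻¹ := by
  have key : ∀ ρ : Equiv.Perm (Fin n), ρ.IsCycle → ρ.support = τ.support →
      (∀ i ∈ ρ.support, τ i = ρ i ∨ ρ (τ i) = i) → (∃ x ∈ ρ.support, τ x = ρ x) → τ = ρ := by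
    rintro ρ hρ hs' h' ⟨x, hx, hτx⟩
    have hstep : ∀ m : ℕ, τ ((ρ ^ m) x) = ρ ((ρ ^ m) x) := by
      intro m
      induction m with
      | zero => exact hτx
      | succ m ih =>
        have hmem : (ρ ^ (m + 1)) x ∈ ρ.support := Equiv.Perm.pow_apply_mem_support.2 hx
        rcases h' _ hmem with h1 | h1
        · exact h1
        · exfalso
          rw [pow_succ', Equiv.Perm.mul_apply] at h1
          have h2 := ρ.injective h1
          rw [← ih] at h2
          have hmem' : (ρ ^ m) x ∈ τ.support := hs' ▸ Equiv.Perm.pow_apply_mem_support.2 hx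
          have h4 : (τ ^ 2) ((ρ ^ m) x) = (ρ ^ m) x := h2
          have h5 := hτ.pow_eq_one_iff.2 ⟨_, Equiv.Perm.mem_support.1 hmem', h4⟩
          have h6 := Nat.le_of_dvd (by norm_num) (orderOf_dvd_of_pow_eq_one h5)
          rw [hτ.orderOf, ← hs] at h6
          omega
    ext i
    by_cases hi : i ∈ ρ.support
    · obtain ⟨m, rfl⟩ := hρ.exists_pow_eq (Equiv.Perm.mem_support.1 hx)
        (Equiv.Perm.mem_support.1 hi)
      rw [hstep]
    · rw [Equiv.Perm.notMem_support.1 hi, Equiv.Perm.notMem_support.1 (hs' ▸ hi)]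
  obtain ⟨x, hx, -⟩ := id hσ
  have hx := Equiv.Perm.mem_support.2 hx
  rcases h x hx with h1 | h1
  · exact Or.inl (key σ hσ hs h ⟨x, hx, h1⟩)
  · refine Or.inr (key σ⁻¹ hσ.inv (by rw [Equiv.Perm.support_inv, hs]) ?_
      ⟨x, by rwa [Equiv.Perm.support_inv], ?_⟩)
    · intro i hi
      rw [Equiv.Perm.support_inv] at hi
      rcases h i hi with h2 | h2
      · exact Or.inr (by rw [h2, perm_inv_apply_self])
      · exact Or.inl (Equiv.Perm.eq_inv_iff_eq.2 h2)
    · exact Equiv.Perm.eq_inv_iff_eq.2 h1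

variable [DecidableRel G.Adj]

theorem inv_mem_graphPerms {l : ℕ} {σ : Equiv.Perm (Fin n)} (hσ : σ ∈ graphPerms G l) :
    σ⁻¹ ∈ graphPerms G l := by
  rw [mem_graphPerms] at hσ ⊢
  rw [Equiv.Perm.support_inv]
  refine ⟨fun i hi => ?_, hσ.2⟩
  have h : σ⁻¹ i ∈ σ.support := by
    rw [← Equiv.Perm.support_inv] at hi ⊢
    exact Equiv.Perm.apply_mem_support.2 hi
  have := hσ.1 _ h
  rw [perm_apply_inv_self] at this
  exact this.symm

/-- For x in the support, a ↦ σ^a x is an isomorphism from the cycle graph: the order of σ is l, so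
indices may be read modulo l, and adding 1 to the index is applying σ. -/
theorem orbitSubgraph_mem_cycles {l : ℕ} (hl : 3 ≤ l) {σ : Equiv.Perm (Fin n)}
    (hσ : σ ∈ graphPerms G l) (hc : σ.IsCycle) : orbitSubgraph G σ ∈ cycles G l := by
  classical
  obtain ⟨h1, h2⟩ := mem_graphPerms.1 hσ
  obtain ⟨m, rfl⟩ := Nat.exists_eq_add_of_le' (show 2 ≤ l by omega)
  obtain ⟨x, hx, -⟩ := id hc
  have hx' := Equiv.Perm.mem_support.2 hx
  have hord : orderOf σ = m + 2 := by rw [hc.orderOf, h2]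
  let f : Fin (m + 2) → (orbitSubgraph G σ).verts := fun a =>
    ⟨(σ ^ (a : ℕ)) x, Equiv.Perm.pow_apply_mem_support.2 hx'⟩
  have hf : ∀ a, ((f (a + 1) : Fin n)) = σ (f a) := by
    intro a
    change (σ ^ ((a + 1 : Fin (m + 2)) : ℕ)) x = σ ((σ ^ (a : ℕ)) x)
    have e : ((a + 1 : Fin (m + 2)) : ℕ) = ((a : ℕ) + 1) % orderOf σ := by
      rw [hord, Fin.val_add, Fin.val_one]
    rw [← Equiv.Perm.mul_apply, ← pow_succ', e, pow_mod_orderOf]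
  have hinj : Function.Injective f := by
    intro a b hab
    have h3 : (σ ^ (a : ℕ)) x = (σ ^ (b : ℕ)) x := congrArg Subtype.val hab
    have h4 := hc.pow_eq_pow_iff.2 ⟨x, hx, h3⟩
    have h5 := pow_inj_mod.1 h4
    rw [hord, Nat.mod_eq_of_lt a.2, Nat.mod_eq_of_lt b.2] at h5
    exact Fin.ext h5
  have hbij : Function.Bijective f := by
    rw [Fintype.bijective_iff_injective_and_card]
    refine ⟨hinj, ?_⟩
    have : Fintype.card (orbitSubgraph G σ).verts = σ.support.card := by
      rw [← Set.toFinset_card]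
      congr 1
      ext v
      simp [orbitSubgraph]
    rw [this, h2, Fintype.card_fin]
  refine Finset.mem_filter.2 ⟨Finset.mem_univ _, ⟨⟨Equiv.ofBijective f hbij, ?_⟩⟩⟩
  intro a b
  change (G.Adj (f a) (f b) ∧ (f a : Fin n) ∈ σ.support ∧
    (σ (f a) = f b ∨ σ (f b) = f a)) ↔ _
  rw [SimpleGraph.cycleGraph_adj, ← hf, ← hf, sub_eq_iff_eq_add', sub_eq_iff_eq_add',
    add_comm b 1, add_comm a 1, Subtype.coe_inj, Subtype.coe_inj, hinj.eq_iff, hinj.eq_iff]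
  constructor
  · rintro ⟨-, -, h⟩
    exact h.symm.imp Eq.symm Eq.symm
  · intro h
    have key : ∀ a, G.Adj (f a) (f (a + 1)) := fun a => by
      rw [hf]
      exact h1 _ (f a).2
    refine ⟨?_, (f a).2, ?_⟩
    · rcases h with h | h
      · rw [h, add_comm 1 b]; exact (key b).symm
      · rw [h, add_comm 1 a]; exact key a
    · exact h.symm.imp Eq.symm Eq.symm

/-- Transport the rotation of the cycle graph along an isomorphism with H and extend it by the
identity outside H. -/
theorem exists_orbitSubgraph_eq {l : ℕ} (hl : 3 ≤ l) {H : G.Subgraph} (hH : H ∈ cycles G l) :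
    ∃ σ ∈ graphPerms G l, σ.IsCycle ∧ orbitSubgraph G σ = H := by
  classical
  obtain ⟨m, rfl⟩ := Nat.exists_eq_add_of_le' (show 2 ≤ l by omega)
  obtain ⟨φ⟩ := (Finset.mem_filter.1 hH).2
  let f : Fin (m + 2) ≃ {v // v ∈ H.verts} := φ.toEquiv
  let σ : Equiv.Perm (Fin n) := (finRotate (m + 2)).extendDomain f
  have hf : ∀ a, σ (f a) = f (a + 1) := by
    intro a
    rw [← finRotate_apply]
    exact Equiv.Perm.extendDomain_apply_image _ f a
  have hoff : ∀ v, v ∉ H.verts → σ v = v := fun v hv =>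
    Equiv.Perm.extendDomain_apply_not_subtype _ f hv
  have hadj : ∀ a b, H.Adj (f a) (f b) ↔ a = b + 1 ∨ b = a + 1 := by
    intro a b
    have h1 : H.coe.Adj (φ a) (φ b) ↔ _ := φ.map_rel_iff
    rw [SimpleGraph.cycleGraph_adj, sub_eq_iff_eq_add', sub_eq_iff_eq_add', add_comm b,
      add_comm a] at h1
    rw [add_comm b, add_comm a]
    exact h1
  have hc : σ.IsCycle := isCycle_finRotate.extendDomain f
  have hmem : ∀ v, v ∈ σ.support ↔ v ∈ H.verts := by
    intro v
    rw [Equiv.Perm.mem_support]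
    constructor
    · intro h
      by_contra h'
      exact h (hoff v h')
    · intro h
      obtain ⟨a, ha⟩ := f.surjective ⟨v, h⟩
      have hv : v = f a := by rw [ha]
      rw [hv, hf]
      intro h'
      have := f.injective (Subtype.ext h')
      simp at this
  refine ⟨σ, mem_graphPerms.2 ⟨?_, ?_⟩, hc, ?_⟩
  · intro v hv
    obtain ⟨a, ha⟩ := f.surjective ⟨v, (hmem v).1 hv⟩
    have hv : v = f a := by rw [ha]
    rw [hv, hf]
    exact H.adj_sub ((hadj _ _).2 (Or.inr rfl))
  · rw [Equiv.Perm.card_support_extend_domain, support_finRotate, Finset.card_univ,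
      Fintype.card_fin]
  · ext u v
    · exact hmem u
    · change (G.Adj u v ∧ u ∈ σ.support ∧ (σ u = v ∨ σ v = u)) ↔ _
      constructor
      · rintro ⟨-, hu, huv⟩
        have hv : v ∈ σ.support := by
          rcases huv with rfl | rfl
          · exact Equiv.Perm.apply_mem_support.2 hu
          · exact Equiv.Perm.apply_mem_support.1 hu
        obtain ⟨a, ha⟩ := f.surjective ⟨u, (hmem u).1 hu⟩
        obtain ⟨b, hb⟩ := f.surjective ⟨v, (hmem v).1 hv⟩
        have hu' : u = f a := by rw [ha]
        have hv' : v = f b := by rw [hb]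
        rw [hu', hv', hadj]
        rw [hu', hv', hf, hf, Subtype.coe_inj, Subtype.coe_inj, f.injective.eq_iff,
          f.injective.eq_iff] at huv
        exact huv.symm.imp Eq.symm Eq.symm
      · intro h
        obtain ⟨a, ha⟩ := f.surjective ⟨u, H.edge_vert h⟩
        obtain ⟨b, hb⟩ := f.surjective ⟨v, H.edge_vert h.symm⟩
        have hu' : u = f a := by rw [ha]
        have hv' : v = f b := by rw [hb]
        refine ⟨H.adj_sub h, (hmem u).2 (H.edge_vert h), ?_⟩
        rw [hu', hv', hadj] at h
        rw [hu', hv', hf, hf]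
        rcases h with rfl | rfl
        · exact Or.inr rfl
        · exact Or.inl rfl

variable (G) in
open Classical in
/-- Summing over the cyclic permutations that move vertices to neighbors amounts to summing over
cycles, each with its two orientations. -/
theorem sum_isCycle_eq_sum_cycles {l : ℕ} (hl : 3 ≤ l) (g : Finset (Fin n) → ℂ) :
    ∑ σ ∈ graphPerms G l with σ.IsCycle, g σ.support
      = 2 * ∑ H ∈ cycles G l, g (vertsOf G H) := by
  rw [← Finset.sum_fiberwise_of_maps_to (t := cycles G l) (g := orbitSubgraph G), Finset.mul_sum]
  · refine Finset.sum_congr rfl fun H hH => ?_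
    obtain ⟨σ, h1, h2, rfl⟩ := exists_orbitSubgraph_eq hl hH
    obtain ⟨hadj, hcard⟩ := mem_graphPerms.1 h1
    have hne : σ ≠ σ⁻¹ := by
      intro h
      have h3 : σ ^ 2 = 1 := by rw [pow_two, ← mul_inv_cancel σ, ← h]
      have h4 := Nat.le_of_dvd (by norm_num) (orderOf_dvd_of_pow_eq_one h3)
      rw [h2.orderOf] at h4
      omega
    -- A cyclic τ with the same subgraph follows the same edges as σ, in one of the two directions.
    have hfib : {τ ∈ {τ ∈ graphPerms G l | τ.IsCycle} |
        orbitSubgraph G τ = orbitSubgraph G σ} = {σ, σ⁻¹} := by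
      ext τ
      simp only [Finset.mem_filter, Finset.mem_insert, Finset.mem_singleton]
      constructor
      · rintro ⟨⟨h3, h4⟩, h5⟩
        have hs : σ.support = τ.support := by
          rw [← vertsOf_orbitSubgraph G σ, ← h5, vertsOf_orbitSubgraph]
        refine IsCycle.eq_or_eq_inv_of_forall h2 h4 hs (by omega) fun i hi => ?_
        have h6 : (orbitSubgraph G τ).Adj i (τ i) :=
          ⟨(mem_graphPerms.1 h3).1 i (hs ▸ hi), hs ▸ hi, Or.inl rfl⟩
        rw [h5] at h6
        exact h6.2.2.imp Eq.symm id
      · rintro (rfl | rfl)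
        · exact ⟨⟨h1, h2⟩, rfl⟩
        · exact ⟨⟨inv_mem_graphPerms h1, h2.inv⟩, orbitSubgraph_inv G σ⟩
    rw [hfib, Finset.sum_pair hne, Equiv.Perm.support_inv, vertsOf_orbitSubgraph, two_mul]
  · intro σ hσ
    exact orbitSubgraph_mem_cycles hl (Finset.mem_filter.1 hσ).1 (Finset.mem_filter.1 hσ).2

end Graph

/-! ### Permutations with at most five non-fixed points -/

section Graph

variable {n : ℕ} {G : SimpleGraph (Fin n)} [DecidableRel G.Adj]

theorem isCycle_of_mem_graphPerms_two {σ : Equiv.Perm (Fin n)} (h : σ ∈ graphPerms G 2) :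
    σ.IsCycle :=
  (Equiv.Perm.card_support_eq_two.1 (mem_graphPerms.1 h).2).isCycle

theorem isCycle_of_mem_graphPerms_three {σ : Equiv.Perm (Fin n)} (h : σ ∈ graphPerms G 3) :
    σ.IsCycle :=
  (card_support_eq_three_iff.1 (mem_graphPerms.1 h).2).isCycle

theorem pow_eq_one_of_mem_graphPerms {s : ℕ} {σ : Equiv.Perm (Fin n)} (h : σ ∈ graphPerms G s)
    (hc : σ.IsCycle) : σ ^ s = 1 := by
  rw [← (mem_graphPerms.1 h).2, ← hc.orderOf, pow_orderOf_eq_one]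

theorem apply_apply_of_mem_graphPerms_two {σ : Equiv.Perm (Fin n)} (h : σ ∈ graphPerms G 2)
    (i : Fin n) : σ (σ i) = i :=
  Equiv.congr_fun (pow_eq_one_of_mem_graphPerms h (isCycle_of_mem_graphPerms_two h)) i

/-- Split off one cycle factor c. The cofactor d is nontrivial as σ is not a cycle, so both supports
have at least two points; this leaves only 4 = 2 + 2 and 5 = 3 + 2 for small s. -/
theorem exists_mul_of_not_isCycle {s : ℕ} (hs : s ≠ 0) {σ : Equiv.Perm (Fin n)}
    (h : σ ∈ graphPerms G s) (hσ : ¬ σ.IsCycle) :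
    ∃ a b, 2 ≤ a ∧ 2 ≤ b ∧ a + b = s ∧ ∃ c ∈ graphPerms G a, ∃ d ∈ graphPerms G b,
      c.Disjoint d ∧ σ = c * d := by
  obtain ⟨h1, h2⟩ := mem_graphPerms.1 h
  have hne : σ ≠ 1 := by
    rintro rfl
    exact hs (by simpa using h2.symm)
  obtain ⟨l, hl⟩ := Multiset.exists_mem_of_ne_zero
    (fun h' => hne (Equiv.Perm.cycleType_eq_zero.1 h'))
  obtain ⟨c, d, rfl, hcd, hc, -⟩ := Equiv.Perm.mem_cycleType_iff.1 hl
  have hd : d ≠ 1 := by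
    rintro rfl
    exact hσ (by rwa [mul_one])
  refine ⟨_, _, hc.two_le_card_support, Equiv.Perm.two_le_card_support_of_ne_one hd, ?_, c,
    mem_graphPerms.2 ⟨fun i hi => ?_, rfl⟩, d, mem_graphPerms.2 ⟨fun i hi => ?_, rfl⟩, hcd, rfl⟩
  · rw [← h2, hcd.card_support_mul]
  · have h3 : i ∈ (c * d).support := by
      rw [hcd.support_mul]
      exact Finset.mem_union_left _ hi
    have h4 := h1 i h3
    rwa [Equiv.Perm.mul_apply, (hcd i).resolve_left (Equiv.Perm.mem_support.1 hi)] at h4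
  · have h3 : i ∈ (c * d).support := by
      rw [hcd.support_mul]
      exact Finset.mem_union_right _ hi
    have h4 := h1 i h3
    rwa [hcd.commute.eq, Equiv.Perm.mul_apply,
      (hcd i).resolve_right (Equiv.Perm.mem_support.1 hi)] at h4

theorem mul_mem_graphPerms {a b : ℕ} {c d : Equiv.Perm (Fin n)} (hc : c ∈ graphPerms G a)
    (hd : d ∈ graphPerms G b) (hcd : c.Disjoint d) : c * d ∈ graphPerms G (a + b) := by
  rw [mem_graphPerms] at *
  refine ⟨fun i hi => ?_, by rw [hcd.card_support_mul, hc.2, hd.2]⟩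
  rw [hcd.support_mul, Finset.mem_union] at hi
  rcases hi with hi | hi
  · rw [Equiv.Perm.mul_apply, (hcd i).resolve_left (Equiv.Perm.mem_support.1 hi)]
    exact hc.1 i hi
  · rw [hcd.commute.eq, Equiv.Perm.mul_apply,
      (hcd i).resolve_right (Equiv.Perm.mem_support.1 hi)]
    exact hd.1 i hi

theorem exists_mul_of_not_isCycle_four {σ : Equiv.Perm (Fin n)} (h : σ ∈ graphPerms G 4)
    (hσ : ¬ σ.IsCycle) :
    ∃ c ∈ graphPerms G 2, ∃ d ∈ graphPerms G 2, c.Disjoint d ∧ σ = c * d := by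
  obtain ⟨a, b, ha, hb, hab, c, hc, d, hd, hcd⟩ := exists_mul_of_not_isCycle (by norm_num) h hσ
  obtain rfl : a = 2 := by omega
  obtain rfl : b = 2 := by omega
  exact ⟨c, hc, d, hd, hcd⟩

theorem exists_mul_of_not_isCycle_five {σ : Equiv.Perm (Fin n)} (h : σ ∈ graphPerms G 5)
    (hσ : ¬ σ.IsCycle) :
    ∃ c ∈ graphPerms G 3, ∃ d ∈ graphPerms G 2, c.Disjoint d ∧ σ = c * d := by
  obtain ⟨a, b, ha, hb, hab, c, hc, d, hd, hcd, rfl⟩ :=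
    exists_mul_of_not_isCycle (by norm_num) h hσ
  have : (a = 3 ∧ b = 2) ∨ (a = 2 ∧ b = 3) := by omega
  rcases this with ⟨rfl, rfl⟩ | ⟨rfl, rfl⟩
  · exact ⟨c, hc, d, hd, hcd, rfl⟩
  · exact ⟨d, hd, c, hc, hcd.symm, hcd.commute.eq⟩

/-- A non-cycle here is a product of two disjoint transpositions, hence an involution, whereas a
4-cycle has order 4. -/
theorem not_isCycle_iff_of_mem_graphPerms_four {σ : Equiv.Perm (Fin n)}
    (h : σ ∈ graphPerms G 4) : ¬ σ.IsCycle ↔ ∀ i, σ (σ i) = i := by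
  constructor
  · intro hσ
    obtain ⟨c, hc, d, hd, hcd, rfl⟩ := exists_mul_of_not_isCycle_four h hσ
    have h2 : (c * d) ^ 2 = 1 := by
      rw [hcd.commute.mul_pow,
        pow_eq_one_of_mem_graphPerms hc (isCycle_of_mem_graphPerms_two hc),
        pow_eq_one_of_mem_graphPerms hd (isCycle_of_mem_graphPerms_two hd), one_mul]
    exact Equiv.congr_fun h2
  · intro h1 h2
    have h3 : σ ^ 2 = 1 := Equiv.ext h1
    have h4 := Nat.le_of_dvd (by norm_num) (orderOf_dvd_of_pow_eq_one h3)
    rw [h2.orderOf, (mem_graphPerms.1 h).2] at h4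
    omega

/-! ### Sums of hook characters over permutations with a given number of moved points -/

section Characters

variable {k : ℕ} (hk : 1 ≤ k) (hkn : k ≤ n)

theorem irrChar_of_mem_graphPerms {s : ℕ} {σ : Equiv.Perm (Fin n)} (h : σ ∈ graphPerms G s)
    (hσ : σ.IsCycle) (hn : s + 1 ≤ n) :
    irrChar (hookPartition n k hk hkn) σ =
      binom (n - (s + 1)) (k - (s + 1)) - (-1) ^ s * binom (n - (s + 1)) (k - 1) := by
  have hs := (mem_graphPerms.1 h).2
  rw [irrChar_hookPartition_isCycle hk hkn hσ (N := n - (s + 1)) (by omega), hσ.sign, hs,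
    show (k : ℤ) - 1 - s = k - (s + 1) by ring]
  push_cast
  ring

theorem irrChar_mul_of_mem_graphPerms {a b : ℕ} {c d : Equiv.Perm (Fin n)}
    (hc : c ∈ graphPerms G a) (hd : d ∈ graphPerms G b) (hc' : c.IsCycle) (hd' : d.IsCycle)
    (hcd : c.Disjoint d) (hn : a + b + 1 ≤ n) :
    irrChar (hookPartition n k hk hkn) (c * d) =
      binom (n - (a + b + 1)) (k - (a + b + 1))
        - (-1) ^ a * binom (n - (a + b + 1)) (k - (b + 1))
        - (-1) ^ b * binom (n - (a + b + 1)) (k - (a + 1))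
        + (-1) ^ (a + b) * binom (n - (a + b + 1)) (k - 1) := by
  have ha := (mem_graphPerms.1 hc).2
  have hb := (mem_graphPerms.1 hd).2
  rw [irrChar_hookPartition_mul hk hkn hc' hd' hcd (N := n - (a + b + 1)) (by omega), hc'.sign,
    hd'.sign, ha, hb, show (k : ℤ) - 1 - a = k - (a + 1) by ring,
    show (k : ℤ) - 1 - b = k - (b + 1) by ring,
    show (k : ℤ) - 1 - (a + b) = k - (a + b + 1) by ring]
  push_cast
  ring

variable (G)

theorem sum_graphPerms_zero (r : ℕ) :
    ∑ σ ∈ graphPerms G 0, irrChar (hookPartition n k hk hkn) σ * degEsymm G σ.supportᶜ r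
      = binom (n - 1) (k - 1) * F G r := by
  have h : graphPerms G 0 = {1} := by
    ext σ
    rw [mem_graphPerms, Finset.mem_singleton, Finset.card_eq_zero, Equiv.Perm.support_eq_empty_iff]
    constructor
    · exact fun h => h.2
    · rintro rfl
      simp
  rw [h, Finset.sum_singleton, irrChar_hookPartition_one, Equiv.Perm.support_one,
    Finset.compl_empty]
  rfl

theorem graphPerms_one : graphPerms G 1 = ∅ := by
  ext σ
  rw [mem_graphPerms]
  have := σ.card_support_ne_one
  simp [this]

theorem sum_graphPerms_two (hn : 3 ≤ n) (r : ℕ) :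
    ∑ σ ∈ graphPerms G 2, irrChar (hookPartition n k hk hkn) σ * degEsymm G σ.supportᶜ (r - 2)
      = swapValue n k * matchingSum G r 1 := by
  rw [matchingSum, Nat.cast_sum, ← sum_involutions_eq_sum_matchings G 1
    (fun S => (degEsymm G Sᶜ (r - 2 * 1) : ℂ)), Finset.filter_true_of_mem, Finset.mul_sum]
  · refine Finset.sum_congr rfl fun σ hσ => ?_
    rw [irrChar_of_mem_graphPerms hk hkn hσ (isCycle_of_mem_graphPerms_two hσ) hn,
      swapValue_eq hk hkn hn]
    norm_num
  · exact fun σ hσ => apply_apply_of_mem_graphPerms_two hσ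

theorem sum_graphPerms_three (hn : 4 ≤ n) (r : ℕ) :
    ∑ σ ∈ graphPerms G 3, irrChar (hookPartition n k hk hkn) σ * degEsymm G σ.supportᶜ (r - 3)
      = 2 * cycleSum G r 3 * (binom (n - 4) (k - 4) + binom (n - 4) (k - 1)) := by
  classical
  rw [cycleSum, Nat.cast_sum, ← sum_isCycle_eq_sum_cycles G le_rfl
    (fun S => (degEsymm G Sᶜ (r - 3) : ℂ)), Finset.filter_true_of_mem, Finset.sum_mul]
  · refine Finset.sum_congr rfl fun σ hσ => ?_
    rw [irrChar_of_mem_graphPerms hk hkn hσ (isCycle_of_mem_graphPerms_three hσ) hn]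
    norm_num
    ring
  · exact fun σ hσ => isCycle_of_mem_graphPerms_three hσ

theorem sum_graphPerms_four (hn : 5 ≤ n) (r : ℕ) :
    ∑ σ ∈ graphPerms G 4, irrChar (hookPartition n k hk hkn) σ * degEsymm G σ.supportᶜ (r - 4)
      = 2 * cycleSum G r 4 * (binom (n - 5) (k - 5) - binom (n - 5) (k - 1))
        + matchingSum G r 2 * (binom (n - 5) (k - 5) - 2 * binom (n - 5) (k - 3)
            + binom (n - 5) (k - 1)) := by
  classical
  rw [← Finset.sum_filter_add_sum_filter_not (graphPerms G 4) (fun σ => σ.IsCycle)]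
  congr 1
  · rw [cycleSum, Nat.cast_sum, ← sum_isCycle_eq_sum_cycles G (by norm_num)
      (fun S => (degEsymm G Sᶜ (r - 4) : ℂ)), Finset.sum_mul]
    refine Finset.sum_congr rfl fun σ hσ => ?_
    obtain ⟨h1, h2⟩ := Finset.mem_filter.1 hσ
    rw [irrChar_of_mem_graphPerms hk hkn h1 h2 hn]
    norm_num
    ring
  · rw [matchingSum, Nat.cast_sum, ← sum_involutions_eq_sum_matchings G 2
      (fun S => (degEsymm G Sᶜ (r - 2 * 2) : ℂ)), Finset.sum_mul,
      ← Finset.filter_congr fun σ hσ => not_isCycle_iff_of_mem_graphPerms_four hσ]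
    refine Finset.sum_congr rfl fun σ hσ => ?_
    obtain ⟨h1, h2⟩ := Finset.mem_filter.1 hσ
    obtain ⟨c, hc, d, hd, hcd, rfl⟩ := exists_mul_of_not_isCycle_four h1 h2
    rw [irrChar_mul_of_mem_graphPerms hk hkn hc hd (isCycle_of_mem_graphPerms_two hc)
      (isCycle_of_mem_graphPerms_two hd) hcd hn]
    norm_num
    ring

/-- Transpositions along edges correspond to edges, and those disjoint from c to the edges that
avoid the triangle on the support of c. -/
theorem card_disjoint_graphPerms_two {c : Equiv.Perm (Fin n)} (hc : c ∈ graphPerms G 3) :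
    (((graphPerms G 2).filter fun d => Disjoint c.support d.support).card : ℂ)
      = G.edgeFinset.card + 3 - ∑ v ∈ c.support, (G.degree v : ℂ) := by
  have h1 := sum_involutions_eq_sum_matchings G 1
    (fun S => if Disjoint c.support S then (1 : ℂ) else 0)
  rw [Finset.filter_true_of_mem fun σ hσ => apply_apply_of_mem_graphPerms_two hσ, matchings_one,
    Finset.powersetCard_one, Finset.sum_map] at h1
  rw [Finset.card_filter]
  push_cast
  rw [h1]
  obtain ⟨hadj, hcard⟩ := mem_graphPerms.1 hc
  have hcyc := isCycle_of_mem_graphPerms_three hc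
  obtain ⟨x, hx, -⟩ := id hcyc
  have hx := Equiv.Perm.mem_support.2 hx
  have hx1 := Equiv.Perm.apply_mem_support.2 hx
  have hx2 := Equiv.Perm.apply_mem_support.2 hx1
  have h3 : c (c (c x)) = x :=
    Equiv.congr_fun (pow_eq_one_of_mem_graphPerms hc hcyc) x
  have hab := hadj _ hx
  have hbc := hadj _ hx1
  have hca := hadj _ hx2
  rw [h3] at hca
  have hsupp : c.support = {x, c x, c (c x)} := by
    symm
    apply Finset.eq_of_subset_of_card_le
    · intro y hy
      simp only [Finset.mem_insert, Finset.mem_singleton] at hy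
      rcases hy with rfl | rfl | rfl <;> assumption
    · rw [hcard, Finset.card_eq_three.2 ⟨_, _, _, hab.ne, hca.ne.symm, hbc.ne, rfl⟩]
  have h4 := card_filter_edgeFinset_triangle G hab hbc hca
  rw [← hsupp] at h4
  have h5 := congrArg (Nat.cast : ℕ → ℂ) h4
  push_cast at h5
  rw [eq_sub_iff_add_eq, ← h5, Finset.card_filter]
  push_cast
  congr 1
  refine Finset.sum_congr rfl fun e _ => if_congr ?_ rfl rfl
  rw [Finset.disjoint_left]
  simp [covered]

-- Each such σ is uniquely c * d with c a 3-cycle and d a disjoint transposition, since c = σ⁴ and d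
-- = σ³. One counts the d for each c; the factor 2 comes from the two orientations of a triangle.
open Classical in
theorem card_not_isCycle_graphPerms_five :
    (((graphPerms G 5).filter fun σ => ¬ σ.IsCycle).card : ℂ)
      = ∑ H ∈ cycles G 3,
          2 * ((G.edgeFinset.card : ℂ) + 3 - ∑ v ∈ vertsOf G H, (G.degree v : ℂ)) := by
  have h1 : ((graphPerms G 5).filter fun σ => ¬ σ.IsCycle).card
      = ((graphPerms G 3 ×ˢ graphPerms G 2).filter
          fun p => Disjoint p.1.support p.2.support).card := by
    symm
    have hpow : ∀ p ∈ (graphPerms G 3 ×ˢ graphPerms G 2).filter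
        (fun p => Disjoint p.1.support p.2.support),
        (p.1 * p.2) ^ 3 = p.2 ∧ (p.1 * p.2) ^ 4 = p.1 := by
      rintro ⟨c, d⟩ hp
      obtain ⟨h1, h2⟩ := Finset.mem_filter.1 hp
      obtain ⟨hc, hd⟩ := Finset.mem_product.1 h1
      have hcd := Equiv.Perm.disjoint_iff_disjoint_support.2 h2
      have hc3 : c ^ 3 = 1 :=
        pow_eq_one_of_mem_graphPerms hc (isCycle_of_mem_graphPerms_three hc)
      have hd2 : d ^ 2 = 1 :=
        pow_eq_one_of_mem_graphPerms hd (isCycle_of_mem_graphPerms_two hd)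
      simp only
      rw [hcd.commute.mul_pow, hcd.commute.mul_pow]
      refine ⟨by rw [hc3, one_mul, pow_succ, hd2, one_mul], ?_⟩
      rw [pow_succ c, hc3, one_mul, show 4 = 2 * 2 by norm_num, pow_mul, hd2, one_pow, mul_one]
    refine Finset.card_bij (fun p _ => p.1 * p.2) ?_ ?_ ?_
    · rintro ⟨c, d⟩ hp
      obtain ⟨h1, h2⟩ := Finset.mem_filter.1 hp
      obtain ⟨hc, hd⟩ := Finset.mem_product.1 h1
      have hcd := Equiv.Perm.disjoint_iff_disjoint_support.2 h2
      have hmem := mul_mem_graphPerms hc hd hcd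
      refine Finset.mem_filter.2 ⟨hmem, fun hcyc => ?_⟩
      have hc3 : c ^ 3 = 1 :=
        pow_eq_one_of_mem_graphPerms hc (isCycle_of_mem_graphPerms_three hc)
      have hd2 : d ^ 2 = 1 :=
        pow_eq_one_of_mem_graphPerms hd (isCycle_of_mem_graphPerms_two hd)
      -- The order divides 6, whereas a cycle with five moved points has order 5.
      have h7 : (c * d) ^ 6 = 1 := by
        rw [hcd.commute.mul_pow, show 6 = 3 * 2 by norm_num, pow_mul, hc3, one_pow, one_mul,
          mul_comm, pow_mul, hd2, one_pow]
      have h8 := orderOf_dvd_of_pow_eq_one h7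
      rw [hcyc.orderOf, (mem_graphPerms.1 hmem).2] at h8
      omega
    · rintro p hp q hq h
      have h3 := hpow p hp
      have h4 := hpow q hq
      rw [h] at h3
      exact Prod.ext (h3.2.symm.trans h4.2) (h3.1.symm.trans h4.1)
    · intro σ hσ
      obtain ⟨h1, h2⟩ := Finset.mem_filter.1 hσ
      obtain ⟨c, hc, d, hd, hcd, rfl⟩ := exists_mul_of_not_isCycle_five h1 h2
      exact ⟨(c, d), Finset.mem_filter.2 ⟨Finset.mem_product.2 ⟨hc, hd⟩,
        Equiv.Perm.disjoint_iff_disjoint_support.1 hcd⟩, rfl⟩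
  rw [h1, Finset.card_filter, Finset.sum_product, Nat.cast_sum, ← Finset.mul_sum,
    ← sum_isCycle_eq_sum_cycles G le_rfl
      (fun S => (G.edgeFinset.card : ℂ) + 3 - ∑ v ∈ S, (G.degree v : ℂ)),
    Finset.filter_true_of_mem fun σ hσ => isCycle_of_mem_graphPerms_three hσ]
  refine Finset.sum_congr rfl fun c hc => ?_
  rw [← card_disjoint_graphPerms_two G hc, Finset.card_filter]

theorem sum_graphPerms_five (hn : 6 ≤ n) :
    ∑ σ ∈ graphPerms G 5, irrChar (hookPartition n k hk hkn) σ * degEsymm G σ.supportᶜ 0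
      = 2 * (cycles G 5).card * (binom (n - 6) (k - 6) + binom (n - 6) (k - 1))
        + ∑ H ∈ cycles G 3,
            2 * ((G.edgeFinset.card : ℂ) + 3 - ∑ v ∈ vertsOf G H, (G.degree v : ℂ))
              * (binom (n - 6) (k - 6) + binom (n - 6) (k - 3)
                - binom (n - 6) (k - 4) - binom (n - 6) (k - 1)) := by
  classical
  simp only [degEsymm_zero, Nat.cast_one, mul_one]
  rw [← Finset.sum_filter_add_sum_filter_not (graphPerms G 5) (fun σ => σ.IsCycle)]
  congr 1
  · have h := sum_isCycle_eq_sum_cycles G (l := 5) (by norm_num) (fun _ => 1)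
    rw [Finset.sum_const (s := cycles G 5), nsmul_one] at h
    rw [← h, Finset.sum_mul]
    refine Finset.sum_congr rfl fun σ hσ => ?_
    obtain ⟨h1, h2⟩ := Finset.mem_filter.1 hσ
    rw [irrChar_of_mem_graphPerms hk hkn h1 h2 hn]
    norm_num
  · rw [← Finset.sum_mul, ← card_not_isCycle_graphPerms_five, ← nsmul_eq_mul]
    apply Finset.sum_eq_card_nsmul
    intro σ hσ
    obtain ⟨h1, h2⟩ := Finset.mem_filter.1 hσ
    obtain ⟨c, hc, d, hd, hcd, rfl⟩ := exists_mul_of_not_isCycle_five h1 h2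
    rw [irrChar_mul_of_mem_graphPerms hk hkn hc hd (isCycle_of_mem_graphPerms_three hc)
      (isCycle_of_mem_graphPerms_two hd) hcd hn]
    norm_num
    ring

end Characters

variable (G)

theorem F_one : F G 1 = 2 * G.edgeFinset.card := by
  rw [← G.sum_degrees_eq_twice_card_edges, F, degEsymm, Finset.esymm_map_val,
    Finset.powersetCard_one, Finset.sum_map]
  simp

theorem matchingSum_two_mul (l : ℕ) : matchingSum G (2 * l) l = (matchings G l).card := by
  simp [matchingSum]

theorem cycleSum_self (l : ℕ) : cycleSum G l l = (cycles G l).card := by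
  simp [cycleSum]

end Graph

end HookImmanant

end

/-! ### Assembly of the coefficients -/

theorem mainTheorem4 (n k m : ℕ) (hk : 1 ≤ k) (hkn : k ≤ n)
    (G : SimpleGraph (Fin n)) [DecidableRel G.Adj] (hm : G.edgeFinset.card = m) (β γ : ℝ)
    (c : ℕ → ℂ)
    (hc : ∀ r, c r = immCoeff (hookPartition n k hk hkn) r
      (linComb G β γ)) :
    immPoly (hookPartition n k hk hkn) (linComb G β γ)
        = ∑ r ∈ Finset.range (n + 1), Polynomial.C ((-1) ^ r * c r) * Polynomial.X ^ (n - r) ∧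
    c 0 = binom (n - 1) (k - 1) ∧
    (c 1 = β * F G 1 * binom (n - 1) (k - 1) ∧
      c 1 = 2 * m * β * binom (n - 1) (k - 1)) ∧
    (3 ≤ n →
      c 2 = β ^ 2 * F G 2 * binom (n - 1) (k - 1)
        + m * γ ^ 2 * swapValue n k) ∧
    (4 ≤ n →
      c 3 = β ^ 3 * F G 3 * binom (n - 1) (k - 1)
        + β * γ ^ 2 * matchingSum G 3 1 * swapValue n k
        + 2 * (cycles G 3).card * γ ^ 3
          * (binom (n - 4) (k - 4) + binom (n - 4) (k - 1))) ∧
    (5 ≤ n →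
      c 4 = β ^ 4 * F G 4 * binom (n - 1) (k - 1)
        + β ^ 2 * γ ^ 2 * matchingSum G 4 1 * swapValue n k
        + 2 * β * γ ^ 3 * cycleSum G 4 3
          * (binom (n - 4) (k - 4) + binom (n - 4) (k - 1))
        + 2 * (cycles G 4).card * γ ^ 4
          * (binom (n - 5) (k - 5) - binom (n - 5) (k - 1))
        + ((m.choose 2 : ℂ) - ∑ v, ((G.degree v).choose 2 : ℂ)) * γ ^ 4
          * (binom (n - 5) (k - 5) - 2 * binom (n - 5) (k - 3)
            + binom (n - 5) (k - 1))) ∧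
    (6 ≤ n →
      c 5 = β ^ 5 * F G 5 * binom (n - 1) (k - 1)
        + β ^ 3 * γ ^ 2 * matchingSum G 5 1 * swapValue n k
        + 2 * β ^ 2 * γ ^ 3 * cycleSum G 5 3
          * (binom (n - 4) (k - 4) + binom (n - 4) (k - 1))
        + 2 * β * γ ^ 4 * cycleSum G 5 4
          * (binom (n - 5) (k - 5) - binom (n - 5) (k - 1))
        + β * γ ^ 4 * matchingSum G 5 2
          * (binom (n - 5) (k - 5) - 2 * binom (n - 5) (k - 3)
            + binom (n - 5) (k - 1))
        + 2 * (cycles G 5).card * γ ^ 5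
          * (binom (n - 6) (k - 6) + binom (n - 6) (k - 1))
        + ∑ H ∈ cycles G 3,
            2 * ((m : ℂ) + 3 - ∑ v ∈ vertsOf G H, (G.degree v : ℂ)) * γ ^ 5
              * (binom (n - 6) (k - 6) + binom (n - 6) (k - 3)
                - binom (n - 6) (k - 4) - binom (n - 6) (k - 1))) := by
  subst hm
  have hcr : ∀ r ≤ n, c r = ∑ s ∈ Finset.range (r + 1), (γ : ℂ) ^ s * (β : ℂ) ^ (r - s) *
      ∑ σ ∈ graphPerms G s, irrChar (hookPartition n k hk hkn) σ
        * degEsymm G σ.supportᶜ (r - s) :=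
    fun r hr => by rw [hc, immCoeff_linComb G _ β γ hr]
  have hF : (F G 1 : ℂ) = 2 * G.edgeFinset.card := by
    rw [F_one]
    push_cast
    rfl
  have hc1 : c 1 = β * F G 1 * binom (n - 1) (k - 1) := by
    rw [hcr 1 (by omega)]
    simp only [Finset.sum_range_succ, Finset.sum_range_zero, graphPerms_one, Finset.sum_empty,
      Nat.reduceSub, sum_graphPerms_zero G hk hkn]
    ring
  refine ⟨?_, ?_, ⟨hc1, ?_⟩, fun hn => ?_, fun hn => ?_, fun hn => ?_, fun hn => ?_⟩
  · rw [immPoly_eq_sum_immCoeff]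
    simp only [hc]
  · rw [hcr 0 (by omega)]
    simp only [Finset.sum_range_succ, Finset.sum_range_zero, Nat.reduceSub,
      sum_graphPerms_zero G hk hkn]
    simp [F]
  · rw [hc1, hF]
    ring
  · have h1 : (matchingSum G 2 1 : ℂ) = G.edgeFinset.card := by
      rw [matchingSum_two_mul G 1, card_matchings_one]
    rw [hcr 2 (by omega)]
    -- The differences r - s are evaluated only in the second pass, because `sum_graphPerms_two`
    -- reads r off from them; the same order is used for the later coefficients.
    simp only [Finset.sum_range_succ, Finset.sum_range_zero, graphPerms_one, Finset.sum_empty,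
      sum_graphPerms_two G hk hkn (show 3 ≤ n by omega), h1]
    simp only [Nat.reduceSub, sum_graphPerms_zero G hk hkn]
    ring
  · rw [hcr 3 (by omega)]
    simp only [Finset.sum_range_succ, Finset.sum_range_zero, graphPerms_one, Finset.sum_empty,
      sum_graphPerms_two G hk hkn (show 3 ≤ n by omega),
      sum_graphPerms_three G hk hkn (show 4 ≤ n by omega), cycleSum_self]
    simp only [Nat.reduceSub, sum_graphPerms_zero G hk hkn]
    ring
  · have h1 : (matchingSum G 4 2 : ℂ)
        = (G.edgeFinset.card.choose 2 : ℂ) - ∑ v, ((G.degree v).choose 2 : ℂ) := by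
      rw [matchingSum_two_mul G 2, ← card_matchings_two]
      push_cast
      ring
    rw [hcr 4 (by omega)]
    simp only [Finset.sum_range_succ, Finset.sum_range_zero, graphPerms_one, Finset.sum_empty,
      sum_graphPerms_two G hk hkn (show 3 ≤ n by omega),
      sum_graphPerms_three G hk hkn (show 4 ≤ n by omega),
      sum_graphPerms_four G hk hkn (show 5 ≤ n by omega), cycleSum_self, h1]
    simp only [Nat.reduceSub, sum_graphPerms_zero G hk hkn]
    ring
  · have h5 : ∑ H ∈ cycles G 3,
        2 * ((G.edgeFinset.card : ℂ) + 3 - ∑ v ∈ vertsOf G H, (G.degree v : ℂ)) * (γ : ℂ) ^ 5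
          * (binom (n - 6) (k - 6) + binom (n - 6) (k - 3)
            - binom (n - 6) (k - 4) - binom (n - 6) (k - 1))
        = (γ : ℂ) ^ 5 * ∑ H ∈ cycles G 3,
          2 * ((G.edgeFinset.card : ℂ) + 3 - ∑ v ∈ vertsOf G H, (G.degree v : ℂ))
            * (binom (n - 6) (k - 6) + binom (n - 6) (k - 3)
              - binom (n - 6) (k - 4) - binom (n - 6) (k - 1)) := by
      rw [Finset.mul_sum]
      exact Finset.sum_congr rfl fun H _ => by ring
    rw [hcr 5 (by omega), h5]
    simp only [Finset.sum_range_succ, Finset.sum_range_zero, graphPerms_one, Finset.sum_empty,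
      sum_graphPerms_two G hk hkn (show 3 ≤ n by omega),
      sum_graphPerms_three G hk hkn (show 4 ≤ n by omega),
      sum_graphPerms_four G hk hkn (show 5 ≤ n by omega)]
    simp only [Nat.reduceSub, sum_graphPerms_zero G hk hkn,
      sum_graphPerms_five G hk hkn (show 6 ≤ n by omega)]
    ring
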